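/- All Hilbert spaces are complex and separable, $\mathcal L(\mathcal X;\mathcal Y)$ denotes the bounded linear operators, $\mathcal L(\mathcal X)=\mathcal L(\mathcal X;\mathcal X)$, $\otimes$ is the Hilbert space tensor product (with the canonical identification $(\mathcal X\otimes\mathcal Y)\otimes\mathcal Z=\mathcal X\otimes(\mathcal Y\otimes\mathcal Z)$), $\dagger$ is the adjoint, and an isometry is a norm-preserving operator. Let $V\in\mathcal L(\mathcal H;\mathcal H\otimes\mathcal H_{E})$, $K\in\mathcal L(\mathcal H)$, and define $L:\mathcal L(\mathcal H)\to\mathcal L(\mathcal H)$ by $L(X)=V^\dagger(X\otimes 1_E)V-K^\dagger X-XK$. Let $\mathcal A\subseteq\mathcal L(\mathcal H)$ be an atomic $*$-subalgebra: for a countable index set $I$, Hilbert spaces $\mathcal H_0$, $\mathcal H_{A_i}$, $\mathcal H_{B_i}$ ($i\in I$) and a unitary $W:\mathcal H_0\oplus\bigoplus_{i\in I}(\mathcal H_{A_i}\otimes\mathcal H_{B_i})\to\mathcal H$, $$\mathcal A=W\Bigl(0\oplus\bigoplus_{i\in I}\bigl(\mathcal L(\mathcal H_{A_i})\otimes 1_{B_i}\bigr)\Bigr)W^\dagger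 .$$ Let $P_0\in\mathcal L(\mathcal H;\mathcal H_0)$ and $P_i\in\mathcal L(\mathcal H;\mathcal H_{A_i}\otimes\mathcal H_{B_i})$ ($i\in I$) be $W^\dagger$ followed by the orthogonal projection onto the corresponding summand. Then the following are equivalent. 1. $L(\mathcal A)\subseteq\mathcal A$. 2. There exist operators $V_0\in\mathcal L(\mathcal H;\mathcal H_0\otimes\mathcal H_E)$ and $K_0\in\mathcal L(\mathcal H;\mathcal H_0)$; for all $i,j\in I$ a Hilbert space $\mathcal H_{F_{ij}}$, an operator $A_{ij}\in\mathcal L(\mathcal H_{A_j};\mathcal H_{A_i}\otimes\mathcal H_{F_{ij}})$ and an isometry $U_{ij}\in\mathcal L(\mathcal H_{F_{ij}}\otimes\mathcal H_{B_j};\mathcal H_{B_i}\otimes\mathcal H_E)$; and for every $i\in I$ operators $B_i\in\mathcal L(\mathcal H_{B_i};\mathcal H_{B_i}\otimes\mathcal H_E)$, $K_{A_i}\in\mathcal L(\mathcal H_{A_i})$ and a self-adjoint $H_{B_i}\in\mathcal L(\mathcal H_{B_i})$ such that $U_{ik}^\dagger U_{il}=\delta_{kl}1$ for all $i,k,l\in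 I$ and, with $V^{sc}_{ij}=(1_{A_i}\otimes U_{ij})(A_{ij}\otimes 1_{B_j})$, $$V=(P_0^\dagger\otimes 1_E)V_0+\sum_{i,j\in I}(P_i^\dagger\otimes 1_E)V^{sc}_{ij}P_j+\sum_{i\in I}(P_i^\dagger\otimes 1_E)(1_{A_i}\otimes B_i)P_i,$$ $$K=\sum_{i,j\in I}P_i^\dagger(1_{A_i}\otimes B_i^\dagger)V^{sc}_{ij}P_j+\tfrac12\sum_{i\in I}P_i^\dagger(1_{A_i}\otimes B_i^\dagger B_i)P_i+K_{\mathcal A}+iH_{\mathcal A'}+P_0^\dagger K_0,$$ where $K_{\mathcal A}=\sum_{i\in I}P_i^\dagger(K_{A_i}\otimes 1_{B_i})P_i$ and $H_{\mathcal A'}=\sum_{i\in I}P_i^\dagger(1_{A_i}\otimes H_{B_i})P_i$, and all series converge in the strong operator topology (to bounded operators). -/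

import Mathlib

open scoped TensorProduct InnerProduct

universe uF

noncomputable section HilbertTensorProduct

/-- The Hilbert space tensor product: the completion of the algebraic tensor product with respect
to the inner product `⟪a ⊗ b, c ⊗ d⟫ = ⟪a, c⟫ * ⟪b, d⟫`. -/
abbrev HilbertTensor (E F : Type*) [NormedAddCommGroup E] [InnerProductSpace ℂ E]
    [NormedAddCommGroup F] [InnerProductSpace ℂ F] : Type _ :=
  UniformSpace.Completion (E ⊗[ℂ] F)

infixl:100 " ⊗ₕ " => HilbertTensor

variable {E F G E' F' : Type*}
  [NormedAddCommGroup E] [InnerProductSpace ℂ E]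
  [NormedAddCommGroup F] [InnerProductSpace ℂ F]
  [NormedAddCommGroup G] [InnerProductSpace ℂ G]
  [NormedAddCommGroup E'] [InnerProductSpace ℂ E']
  [NormedAddCommGroup F'] [InnerProductSpace ℂ F']

/-- The elementary tensor of two vectors. -/
def HilbertTensor.tmul (x : E) (y : F) : E ⊗ₕ F := ((x ⊗ₜ[ℂ] y : E ⊗[ℂ] F) : E ⊗ₕ F)

/-- The tensor product `f ⊗ g` of two bounded operators. -/
def HilbertTensor.map (f : E →L[ℂ] E') (g : F →L[ℂ] F') : E ⊗ₕ F →L[ℂ] E' ⊗ₕ F' :=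
  (TensorProduct.mapL f g).completion

theorem HilbertTensor.map_tmul (f : E →L[ℂ] E') (g : F →L[ℂ] F') (x : E) (y : F) :
    HilbertTensor.map f g (HilbertTensor.tmul x y) = HilbertTensor.tmul (f x) (g y) := by
  simp [HilbertTensor.map, HilbertTensor.tmul]

variable (E F G) in
/-- The dense isometric embedding of the algebraic tensor product of three spaces into the
iterated Hilbert space tensor product, bracketed to the left. -/
def HilbertTensor.inclLeft : (E ⊗[ℂ] F) ⊗[ℂ] G →ₗᵢ[ℂ] (E ⊗ₕ F) ⊗ₕ G :=
  UniformSpace.Completion.toComplₗᵢ.comp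
    ((UniformSpace.Completion.toComplₗᵢ (𝕜 := ℂ) (E := E ⊗[ℂ] F)).rTensor G)

variable (E F G) in
/-- The dense isometric embedding of the algebraic tensor product of three spaces into the
iterated Hilbert space tensor product, bracketed to the right. -/
def HilbertTensor.inclRight : E ⊗[ℂ] (F ⊗[ℂ] G) →ₗᵢ[ℂ] E ⊗ₕ (F ⊗ₕ G) :=
  UniformSpace.Completion.toComplₗᵢ.comp
    ((UniformSpace.Completion.toComplₗᵢ (𝕜 := ℂ) (E := F ⊗[ℂ] G)).lTensor E)

theorem HilbertTensor.denseRange_mapIsometry (f : E →ₗᵢ[ℂ] E') (g : F →ₗᵢ[ℂ] F')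
    (hf : DenseRange f) (hg : DenseRange g) :
    DenseRange (TensorProduct.mapIsometry f g) := by
  intro z
  change z ∈ (LinearMap.range (TensorProduct.mapIsometry f g).toLinearMap).topologicalClosure
  induction z using TensorProduct.induction_on with
  | zero => exact zero_mem _
  | tmul x y =>
    refine map_mem_closure (f := fun q : E' × F' => q.1 ⊗ₜ[ℂ] q.2)
      TensorProduct.continuous_tmul (hf.prodMap hg (x, y)) ?_
    rintro _ ⟨p, rfl⟩
    exact ⟨p.1 ⊗ₜ p.2, by simp⟩
  | add a b ha hb => exact add_mem ha hb

theorem HilbertTensor.denseRange_inclLeft :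
    DenseRange (HilbertTensor.inclLeft E F G).toLinearMap := by
  refine DenseRange.comp (f := fun x => (TensorProduct.mapIsometry
    (UniformSpace.Completion.toComplₗᵢ (𝕜 := ℂ) (E := E ⊗[ℂ] F))
    (LinearIsometry.id (R := ℂ) (E := G))) x)
    UniformSpace.Completion.denseRange_coe ?_ (UniformSpace.Completion.continuous_coe _)
  exact HilbertTensor.denseRange_mapIsometry _ _ UniformSpace.Completion.denseRange_coe
    (Function.surjective_id.denseRange)

theorem HilbertTensor.denseRange_inclRight :
    DenseRange (HilbertTensor.inclRight E F G).toLinearMap := by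
  refine DenseRange.comp (f := fun x => (TensorProduct.mapIsometry
    (LinearIsometry.id (R := ℂ) (E := E))
    (UniformSpace.Completion.toComplₗᵢ (𝕜 := ℂ) (E := F ⊗[ℂ] G))) x)
    UniformSpace.Completion.denseRange_coe ?_ (UniformSpace.Completion.continuous_coe _)
  exact HilbertTensor.denseRange_mapIsometry _ _ (Function.surjective_id.denseRange)
    UniformSpace.Completion.denseRange_coe

variable (E F G) in
/-- The associativity unitary `(E ⊗ F) ⊗ G ≃ E ⊗ (F ⊗ G)`, `(x ⊗ y) ⊗ z ↦ x ⊗ (y ⊗ z)`. -/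
def HilbertTensor.assoc : (E ⊗ₕ F) ⊗ₕ G ≃ₗᵢ[ℂ] E ⊗ₕ (F ⊗ₕ G) :=
  (TensorProduct.assoc ℂ E F G).extendOfIsometry
    (HilbertTensor.inclLeft E F G).toLinearMap (HilbertTensor.inclRight E F G).toLinearMap
    HilbertTensor.denseRange_inclLeft HilbertTensor.denseRange_inclRight
    (fun x => by
      change ‖HilbertTensor.inclRight E F G _‖ = ‖HilbertTensor.inclLeft E F G x‖
      rw [LinearIsometry.norm_map, LinearIsometry.norm_map, TensorProduct.norm_assoc])

theorem HilbertTensor.assoc_tmul (x : E) (y : F) (z : G) :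
    HilbertTensor.assoc E F G (HilbertTensor.tmul (HilbertTensor.tmul x y) z) =
      HilbertTensor.tmul x (HilbertTensor.tmul y z) :=
  LinearEquiv.extendOfIsometry_eq (TensorProduct.assoc ℂ E F G)
    (HilbertTensor.inclLeft E F G).toLinearMap (HilbertTensor.inclRight E F G).toLinearMap
    HilbertTensor.denseRange_inclLeft HilbertTensor.denseRange_inclRight _
    ((x ⊗ₜ y) ⊗ₜ z)

end HilbertTensorProduct

noncomputable section NormalForm

/-- The series `∑ i, f i` of bounded operators converges to `T` in the strong operator topology. -/
def SOTHasSum {ι E F : Type*} [NormedAddCommGroup E] [NormedSpace ℂ E]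
    [NormedAddCommGroup F] [NormedSpace ℂ F] (f : ι → E →L[ℂ] F) (T : E →L[ℂ] F) : Prop :=
  ∀ x : E, HasSum (fun i => f i x) (T x)

variable {H HE : Type*}
  [NormedAddCommGroup H] [InnerProductSpace ℂ H] [CompleteSpace H]
  [NormedAddCommGroup HE] [InnerProductSpace ℂ HE]

/-- The map `L(X) = V† (X ⊗ 1) V - K† X - X K` on the bounded operators on `H`. -/
def gklsMap (V : H →L[ℂ] H ⊗ₕ HE) (K : H →L[ℂ] H) (X : H →L[ℂ] H) : H →L[ℂ] H :=
  V† ∘L HilbertTensor.map X (.id ℂ HE) ∘L V - K† ∘L X - X ∘L K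

variable {I : Type*} {H₀ : Type*} {HA HB : I → Type*}
  [NormedAddCommGroup H₀] [InnerProductSpace ℂ H₀]
  [∀ i, NormedAddCommGroup (HA i)] [∀ i, InnerProductSpace ℂ (HA i)]
  [∀ i, NormedAddCommGroup (HB i)] [∀ i, InnerProductSpace ℂ (HB i)]

variable (H₀ HA HB) in
/-- The Hilbert space direct sum `H₀ ⊕ ⨁ i, (HA i ⊗ HB i)`. -/
abbrev BlockSpace : Type _ :=
  WithLp 2 (H₀ × lp (fun i => HA i ⊗ₕ HB i) 2)

/-- The operator `P₀ : H → H₀`: the inverse of the unitary `U` followed by the orthogonal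
projection onto the summand `H₀`. -/
def nullProj (U : BlockSpace H₀ HA HB ≃ₗᵢ[ℂ] H) : H →L[ℂ] H₀ :=
  WithLp.fstL 2 ℂ H₀ (lp (fun i => HA i ⊗ₕ HB i) 2) ∘L
    (U.symm.toContinuousLinearEquiv : H →L[ℂ] BlockSpace H₀ HA HB)

/-- The operator `P i : H → HA i ⊗ HB i`: the inverse of the unitary `U` followed by the orthogonal
projection onto the `i`-th summand. -/
def blockProj (U : BlockSpace H₀ HA HB ≃ₗᵢ[ℂ] H) (i : I) : H →L[ℂ] HA i ⊗ₕ HB i :=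
  lp.evalCLM ℂ (fun i => HA i ⊗ₕ HB i) 2 i ∘L
    WithLp.sndL 2 ℂ H₀ (lp (fun i => HA i ⊗ₕ HB i) 2) ∘L
      (U.symm.toContinuousLinearEquiv : H →L[ℂ] BlockSpace H₀ HA HB)

/-- The *-subalgebra `𝒜` is the atomic algebra `U (0 ⊕ ⨁ i, (L(HA i) ⊗ 1)) U†`: a bounded operator
`X` belongs to `𝒜` iff `U† X U` acts as `0` on `H₀` and as `Y i ⊗ 1` on the `i`-th block, for some
uniformly bounded family `Y i` of operators. -/
def IsAtomicWith (𝒜 : NonUnitalStarSubalgebra ℂ (H →L[ℂ] H))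
    (U : BlockSpace H₀ HA HB ≃ₗᵢ[ℂ] H) : Prop :=
  ∀ X : H →L[ℂ] H, X ∈ 𝒜 ↔
    ∃ Y : ∀ i, HA i →L[ℂ] HA i, BddAbove (Set.range fun i => ‖Y i‖) ∧
      ∀ ψ : BlockSpace H₀ HA HB, (U.symm (X (U ψ))).fst = 0 ∧
        ∀ i, (U.symm (X (U ψ))).snd i = HilbertTensor.map (Y i) (.id ℂ (HB i)) (ψ.snd i)

end NormalForm

noncomputable section Blocks

variable {A A' B B' F HE : Type*}
  [NormedAddCommGroup A] [InnerProductSpace ℂ A]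
  [NormedAddCommGroup A'] [InnerProductSpace ℂ A']
  [NormedAddCommGroup B] [InnerProductSpace ℂ B]
  [NormedAddCommGroup B'] [InnerProductSpace ℂ B']
  [NormedAddCommGroup F] [InnerProductSpace ℂ F]
  [NormedAddCommGroup HE] [InnerProductSpace ℂ HE]

/-- The operator `1 ⊗ T : A ⊗ B' → (A ⊗ B) ⊗ E` for `T : B' → B ⊗ E`. -/
def ampRight (A : Type*) [NormedAddCommGroup A] [InnerProductSpace ℂ A]
    (T : B' →L[ℂ] B ⊗ₕ HE) : A ⊗ₕ B' →L[ℂ] (A ⊗ₕ B) ⊗ₕ HE :=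
  ((HilbertTensor.assoc A B HE).symm.toContinuousLinearEquiv :
      A ⊗ₕ (B ⊗ₕ HE) →L[ℂ] (A ⊗ₕ B) ⊗ₕ HE) ∘L
    HilbertTensor.map (.id ℂ A) T

/-- The operator `1 ⊗ S : (A ⊗ B) ⊗ E → A ⊗ B'` for `S : B ⊗ E → B'`. -/
def ampRightOut (A : Type*) [NormedAddCommGroup A] [InnerProductSpace ℂ A]
    (S : B ⊗ₕ HE →L[ℂ] B') : (A ⊗ₕ B) ⊗ₕ HE →L[ℂ] A ⊗ₕ B' :=
  HilbertTensor.map (.id ℂ A) S ∘L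
    ((HilbertTensor.assoc A B HE).toContinuousLinearEquiv :
      (A ⊗ₕ B) ⊗ₕ HE →L[ℂ] A ⊗ₕ (B ⊗ₕ HE))

/-- The operator `(1 ⊗ U) (T ⊗ 1) : A' ⊗ B' → (A ⊗ B) ⊗ E` for `T : A' → A ⊗ F` and
`U : F ⊗ B' → B ⊗ E`. -/
def semilocal (U : F ⊗ₕ B' →L[ℂ] B ⊗ₕ HE) (T : A' →L[ℂ] A ⊗ₕ F) :
    A' ⊗ₕ B' →L[ℂ] (A ⊗ₕ B) ⊗ₕ HE :=
  ampRight A U ∘L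
    ((HilbertTensor.assoc A F B').toContinuousLinearEquiv :
      (A ⊗ₕ F) ⊗ₕ B' →L[ℂ] A ⊗ₕ (F ⊗ₕ B')) ∘L
    HilbertTensor.map T (.id ℂ B')

end Blocks

/-! The proof rests on a gauge freedom. If `T` intertwines `X` with `X ⊗ 1` and `T†` intertwines
them back, then replacing `(V, K)` by `(V + T, K + T†V + ½T†T)` leaves `L(X)` unchanged
(`gklsMap_gauge`). Block diagonal sums `T` of operators `1 ⊗ B i` have this property for every `X`
in the algebra.

Sufficiency: the gauge removes the `B i`. The null rows and the operators `1 ⊗ H` drop out of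
`L(X)`, and what remains is `S†(X ⊗ 1)S - k†X - Xk` with `k` in the algebra. Since `U†U` is the
identity on equal indices and zero on different ones, the first term has diagonal blocks in `L(HA i)
⊗ 1` and no others.

Necessity: the `B i` are chosen so that after the gauge the slice of each diagonal block of `V` at a
unit vector `a₀` vanishes (`exists_gauge`). Then `L` is tested on elements supported in one block
`k`, with `Y ⊗ 1` there and `Y` often of rank one. With `V_ki` the block of `V` from `i` to `k`, the
vanishing slice separates the contributions of `V` and `K`. The off-diagonal blocks of `K` vanish,
`V_ki†(Y ⊗ 1)V_kj = 0` for `i ≠ j`, and `V_ki†(Y ⊗ 1)V_ki` lies in `L(HA i) ⊗ 1`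
(`isLeftAmplification_conj`). The diagonal blocks of `K` then split as `f ⊗ 1 + i(1 ⊗ g)`
(`exists_map_add_map`).

A Stinespring-type argument on the partial matrix elements of `V_ki` gives the semilocal form
(`exists_semilocal_factorization`). The orthogonality of the blocks in each row yields both the
orthogonal isometries and the convergence of the double series (`sotHasSum_blocks`). -/

open scoped TensorProduct InnerProduct InnerProductSpace

/-! ### Calculus of Hilbert tensor products: density, slices, reassociation. -/

noncomputable section TensorBasics

namespace HilbertTensor

variable {E F G E' F' E'' F'' : Type*}
  [NormedAddCommGroup E] [InnerProductSpace ℂ E]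
  [NormedAddCommGroup F] [InnerProductSpace ℂ F]
  [NormedAddCommGroup G] [InnerProductSpace ℂ G]
  [NormedAddCommGroup E'] [InnerProductSpace ℂ E']
  [NormedAddCommGroup F'] [InnerProductSpace ℂ F']
  [NormedAddCommGroup E''] [InnerProductSpace ℂ E'']
  [NormedAddCommGroup F''] [InnerProductSpace ℂ F'']

theorem inner_tmul (x x' : E) (y y' : F) :
    ⟪tmul x y, tmul x' y'⟫_ℂ = ⟪x, x'⟫_ℂ * ⟪y, y'⟫_ℂ := by
  simp [tmul, UniformSpace.Completion.inner_coe]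

theorem norm_tmul (x : E) (y : F) : ‖tmul x y‖ = ‖x‖ * ‖y‖ := by
  simp [tmul]

variable (E F) in
/-- The elementary tensor as a bounded bilinear map. -/
def tmulL : E →L[ℂ] F →L[ℂ] E ⊗ₕ F :=
  (ContinuousLinearMap.compL ℂ F (E ⊗[ℂ] F) (E ⊗ₕ F) UniformSpace.Completion.toComplL) ∘L
    TensorProduct.mkL ℂ E F

@[simp] theorem tmulL_apply (x : E) (y : F) : tmulL E F x y = tmul x y := rfl

theorem tmul_smul_left (c : ℂ) (x : E) (y : F) : tmul (c • x) y = c • tmul x y := by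
  simp [← tmulL_apply]

theorem tmul_smul_right (c : ℂ) (x : E) (y : F) : tmul x (c • y) = c • tmul x y := by
  simp [← tmulL_apply]

theorem tmul_zero_left (y : F) : tmul (0 : E) y = 0 := by simp [← tmulL_apply]

theorem tmul_zero_right (x : E) : tmul x (0 : F) = 0 := by simp [← tmulL_apply]

theorem topologicalClosure_span_tmul :
    (Submodule.span ℂ (Set.range fun p : E × F => tmul p.1 p.2)).topologicalClosure = ⊤ := by
  rw [eq_top_iff]
  rintro z -
  have hz := UniformSpace.Completion.denseRange_coe (α := E ⊗[ℂ] F) z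
  refine closure_mono ?_ hz
  rintro _ ⟨t, rfl⟩
  induction t using TensorProduct.induction_on with
  | zero => exact zero_mem _
  | tmul x y => exact Submodule.subset_span ⟨(x, y), rfl⟩
  | add a b ha hb =>
    rw [UniformSpace.Completion.coe_add]
    exact add_mem ha hb

theorem clm_ext {X : Type*} [NormedAddCommGroup X] [NormedSpace ℂ X]
    {S T : E ⊗ₕ F →L[ℂ] X} (h : ∀ x y, S (tmul x y) = T (tmul x y)) : S = T := by
  have hc : IsClosed {z | S z = T z} := isClosed_eq S.continuous T.continuous
  have : (⊤ : Submodule ℂ (E ⊗ₕ F)) ≤ LinearMap.eqLocus (S : E ⊗ₕ F →ₗ[ℂ] X) T := by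
    rw [← topologicalClosure_span_tmul]
    refine Submodule.topologicalClosure_minimal _ (Submodule.span_le.2 ?_) hc
    rintro _ ⟨p, rfl⟩
    exact h p.1 p.2
  ext1 z
  exact this (Submodule.mem_top (x := z))

theorem ext_inner {z w : E ⊗ₕ F} (h : ∀ x y, ⟪tmul x y, z⟫_ℂ = ⟪tmul x y, w⟫_ℂ) : z = w := by
  refine ext_inner_right ℂ fun v => ?_
  rw [← inner_conj_symm, ← inner_conj_symm w]
  congr 1
  have := clm_ext (S := innerSL ℂ z) (T := innerSL ℂ w) (fun x y => by
    simp only [innerSL_apply_apply]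
    rw [← inner_conj_symm, h, inner_conj_symm])
  rw [← inner_conj_symm, ← inner_conj_symm v]
  congr 1
  exact DFunLike.congr_fun this v

theorem clm_ext_inner {S T : E ⊗ₕ F →L[ℂ] E' ⊗ₕ F'}
    (h : ∀ x y x' y', ⟪tmul x y, S (tmul x' y')⟫_ℂ = ⟪tmul x y, T (tmul x' y')⟫_ℂ) : S = T :=
  clm_ext fun x' y' => ext_inner fun x y => h x y x' y'

@[simp] theorem map_id_id : map (.id ℂ E) (.id ℂ F) = .id ℂ (E ⊗ₕ F) :=
  clm_ext fun x y => by simp [map_tmul]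

theorem map_comp (f' : E' →L[ℂ] E'') (f : E →L[ℂ] E') (g' : F' →L[ℂ] F'') (g : F →L[ℂ] F') :
    map (f' ∘L f) (g' ∘L g) = map f' g' ∘L map f g :=
  clm_ext fun x y => by simp [map_tmul]

theorem map_comp_apply (f' : E' →L[ℂ] E'') (f : E →L[ℂ] E') (g' : F' →L[ℂ] F'')
    (g : F →L[ℂ] F') (z : E ⊗ₕ F) : map f' g' (map f g z) = map (f' ∘L f) (g' ∘L g) z := by
  rw [map_comp]; rfl

@[simp] theorem map_zero_left (g : F →L[ℂ] F') : map (0 : E →L[ℂ] E') g = 0 :=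
  clm_ext fun x y => by simp [map_tmul, tmul_zero_left]

theorem norm_map_le (f : E →L[ℂ] E') (g : F →L[ℂ] F') : ‖map f g‖ ≤ ‖f‖ * ‖g‖ := by
  refine ContinuousLinearMap.opNorm_le_bound _ (by positivity) fun z => ?_
  induction z using UniformSpace.Completion.induction_on with
  | hp => exact isClosed_le (by fun_prop) (by fun_prop)
  | ih t =>
    rw [map, ContinuousLinearMap.completion_apply_coe, UniformSpace.Completion.norm_coe,
      UniformSpace.Completion.norm_coe]
    exact ((TensorProduct.mapL f g).le_opNorm t).trans
      (mul_le_mul_of_nonneg_right (TensorProduct.norm_mapL_le f g) (norm_nonneg _))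

theorem norm_map_id_left_le (g : F →L[ℂ] F') : ‖map (.id ℂ E) g‖ ≤ ‖g‖ :=
  (norm_map_le _ g).trans <| by
    simpa using mul_le_mul_of_nonneg_right (ContinuousLinearMap.norm_id_le (𝕜 := ℂ) (E := E))
      (norm_nonneg g)

theorem norm_map_id_right_le (f : E →L[ℂ] E') : ‖map f (.id ℂ F)‖ ≤ ‖f‖ :=
  (norm_map_le f _).trans <| by
    simpa using mul_le_mul_of_nonneg_left (ContinuousLinearMap.norm_id_le (𝕜 := ℂ) (E := F))
      (norm_nonneg f)

section Complete

variable [CompleteSpace E] [CompleteSpace F] [CompleteSpace E'] [CompleteSpace F']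

theorem adjoint_map (f : E →L[ℂ] E') (g : F →L[ℂ] F') : (map f g)† = map (f†) (g†) :=
  clm_ext_inner fun x y x' y' => by
    simp [map_tmul, inner_tmul, ← ContinuousLinearMap.adjoint_inner_left]

theorem adjoint_id : (ContinuousLinearMap.id ℂ E)† = .id ℂ E :=
  ContinuousLinearMap.adjoint_id

end Complete

/-- The isometric extension of a bounded bilinear map which multiplies inner products. -/
theorem exists_lift_isometry [CompleteSpace G] (e : E →ₗ[ℂ] F →L[ℂ] G)
    (he : ∀ x y x' y', ⟪e x y, e x' y'⟫_ℂ = ⟪x, x'⟫_ℂ * ⟪y, y'⟫_ℂ) :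
    ∃ U : E ⊗ₕ F →L[ℂ] G, Isometry U ∧ ∀ x y, U (tmul x y) = e x y := by
  let l : E ⊗[ℂ] F →ₗ[ℂ] G :=
    TensorProduct.lift ((ContinuousLinearMap.coeLM ℂ : (F →L[ℂ] G) →ₗ[ℂ] F →ₗ[ℂ] G) ∘ₗ e)
  have hl : ∀ x y, l (x ⊗ₜ y) = e x y := fun x y => by simp [l]
  have hin : ∀ s t, ⟪l s, l t⟫_ℂ = ⟪s, t⟫_ℂ := by
    intro s t
    induction s using TensorProduct.induction_on with
    | zero => simp
    | add a b ha hb => simp [inner_add_left, ha, hb]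
    | tmul x y =>
      induction t using TensorProduct.induction_on with
      | zero => simp
      | add a b ha hb => simp only [map_add, inner_add_right, ha, hb]
      | tmul x' y' => rw [hl, hl, he, TensorProduct.inner_tmul]
  let li : E ⊗[ℂ] F →ₗᵢ[ℂ] G := l.isometryOfInner hin
  refine ⟨li.toContinuousLinearMap.fromCompletion, ?_, fun x y => ?_⟩
  · refine AddMonoidHomClass.isometry_of_norm _ fun z => ?_
    induction z using UniformSpace.Completion.induction_on with
    | hp => exact isClosed_eq (by fun_prop) (by fun_prop)
    | ih t =>
      rw [ContinuousLinearMap.fromCompletion_apply_coe, UniformSpace.Completion.norm_coe]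
      exact li.norm_map t
  · rw [tmul, ContinuousLinearMap.fromCompletion_apply_coe]
    exact hl x y

section Slice

variable [CompleteSpace F]

variable (F) in
/-- The slice map `⟨a| ⊗ 1 : E ⊗ F → F`. -/
def slice (a : E) : E ⊗ₕ F →L[ℂ] F := (tmulL E F a)†

theorem inner_slice (a : E) (y : F) (z : E ⊗ₕ F) : ⟪y, slice F a z⟫_ℂ = ⟪tmul a y, z⟫_ℂ := by
  rw [slice, ContinuousLinearMap.adjoint_inner_right, tmulL_apply]

theorem slice_tmul (a x : E) (y : F) : slice F a (tmul x y) = ⟪a, x⟫_ℂ • y :=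
  ext_inner_left ℂ fun v => by rw [inner_slice, inner_tmul, inner_smul_right]

theorem norm_slice_le (a : E) : ‖slice F a‖ ≤ ‖a‖ := by
  rw [slice, LinearIsometryEquiv.norm_map]
  exact ContinuousLinearMap.opNorm_le_bound _ (norm_nonneg _) fun y => (norm_tmul a y).le

theorem ext_slice {z w : E ⊗ₕ F} (h : ∀ a, slice F a z = slice F a w) : z = w :=
  ext_inner fun x y => by rw [← inner_slice, h, inner_slice]

theorem slice_map_id_left [CompleteSpace F'] (a : E) (g : F →L[ℂ] F') (z : E ⊗ₕ F) :
    slice F' a (map (.id ℂ E) g z) = g (slice F a z) := by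
  have := clm_ext (S := slice F' a ∘L map (.id ℂ E) g) (T := g ∘L slice F a) fun x y => by
    simp [map_tmul, slice_tmul]
  exact DFunLike.congr_fun this z

theorem slice_assoc [CompleteSpace G] (a : E) (z : (E ⊗ₕ F) ⊗ₕ G) :
    slice (F ⊗ₕ G) a (assoc E F G z) = map (slice F a) (.id ℂ G) z := by
  have := clm_ext (S := slice (F ⊗ₕ G) a ∘L
      ((assoc E F G).toContinuousLinearEquiv : (E ⊗ₕ F) ⊗ₕ G →L[ℂ] E ⊗ₕ (F ⊗ₕ G)))
    (T := map (slice F a) (.id ℂ G)) fun x y => by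
      -- The outer extensionality leaves an arbitrary vector of `E ⊗ F` in the first factor. With
      -- `y` fixed, a second density argument reduces it to elementary tensors.
      refine DFunLike.congr_fun (clm_ext (S := slice (F ⊗ₕ G) a ∘L
        ((assoc E F G).toContinuousLinearEquiv : (E ⊗ₕ F) ⊗ₕ G →L[ℂ] E ⊗ₕ (F ⊗ₕ G)) ∘L
          (tmulL (E ⊗ₕ F) G).flip y) (T := (tmulL F G).flip y ∘L slice F a) fun x₁ x₂ => ?_) x
        |>.trans ?_
      · simp [assoc_tmul, slice_tmul]
      · simp [map_tmul]
  exact DFunLike.congr_fun this z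

end Slice

theorem assoc_map_map_id {E F G E' F' G' : Type*}
    [NormedAddCommGroup E] [InnerProductSpace ℂ E]
    [NormedAddCommGroup F] [InnerProductSpace ℂ F]
    [NormedAddCommGroup G] [InnerProductSpace ℂ G]
    [NormedAddCommGroup E'] [InnerProductSpace ℂ E']
    [NormedAddCommGroup F'] [InnerProductSpace ℂ F']
    [NormedAddCommGroup G'] [InnerProductSpace ℂ G']
    (f : E →L[ℂ] E') (g : F →L[ℂ] F') (h : G →L[ℂ] G') (z : (E ⊗ₕ F) ⊗ₕ G) :
    assoc E' F' G' (map (map f g) h z) = map f (map g h) (assoc E F G z) := by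
  have := clm_ext
    (S := ((assoc E' F' G').toContinuousLinearEquiv : (E' ⊗ₕ F') ⊗ₕ G' →L[ℂ] _) ∘L
      map (map f g) h)
    (T := map f (map g h) ∘L
      ((assoc E F G).toContinuousLinearEquiv : (E ⊗ₕ F) ⊗ₕ G →L[ℂ] _)) fun x y => by
      refine DFunLike.congr_fun (clm_ext (S :=
        ((assoc E' F' G').toContinuousLinearEquiv : (E' ⊗ₕ F') ⊗ₕ G' →L[ℂ] _) ∘L
          map (map f g) h ∘L (tmulL (E ⊗ₕ F) G).flip y)
        (T := map f (map g h) ∘L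
          ((assoc E F G).toContinuousLinearEquiv : (E ⊗ₕ F) ⊗ₕ G →L[ℂ] _) ∘L
            (tmulL (E ⊗ₕ F) G).flip y) fun x₁ x₂ => ?_) x
      simp [assoc_tmul, map_tmul]
  exact DFunLike.congr_fun this z

theorem separableSpace [TopologicalSpace.SeparableSpace E] [TopologicalSpace.SeparableSpace F] :
    TopologicalSpace.SeparableSpace (E ⊗ₕ F) := by
  have hc : Continuous fun p : E × F => tmul p.1 p.2 :=
    (UniformSpace.Completion.continuous_coe _).comp TensorProduct.continuous_tmul
  have h1 := (TopologicalSpace.isSeparable_range hc).span (R := ℂ)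
  have h2 := h1.closure
  rw [← TopologicalSpace.isSeparable_univ_iff]
  convert h2
  exact (congrArg SetLike.coe (topologicalClosure_span_tmul (E := E) (F := F))).symm

end HilbertTensor

end TensorBasics

/-! ### Operators of the form `Y ⊗ 1`, and how the generator condition detects them. -/

noncomputable section LeftAmplification

open HilbertTensor InnerProductSpace

variable {A B G : Type*}
  [NormedAddCommGroup A] [InnerProductSpace ℂ A]
  [NormedAddCommGroup B] [InnerProductSpace ℂ B]
  [NormedAddCommGroup G] [InnerProductSpace ℂ G]

/-- The Hilbert spaces may be zero, where no unit vector exists. This form still supplies a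
reference vector and a norm bound valid in all cases. -/
theorem exists_norm_le_one_unit (A : Type*) [NormedAddCommGroup A] [NormedSpace ℂ A] :
    ∃ a : A, ‖a‖ ≤ 1 ∧ (Nontrivial A → ‖a‖ = 1) := by
  rcases subsingleton_or_nontrivial A with h | h
  · exact ⟨0, by simp, fun h' => absurd h (not_subsingleton_iff_nontrivial.2 h')⟩
  · obtain ⟨a, ha⟩ := NormedSpace.sphere_nonempty (E := A) (x := 0) (r := 1) |>.2 zero_le_one
    rw [mem_sphere_zero_iff_norm] at ha
    exact ⟨a, ha.le, fun _ => ha⟩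

/-- The matrix elements of an operator on `A ⊗ B` depend on the vectors of `B` only through their
inner product; equivalently, the operator has the form `Y ⊗ 1`. -/
def IsLeftAmplification (N : A ⊗ₕ B →L[ℂ] A ⊗ₕ B) : Prop :=
  ∃ s : A → A → ℂ, ∀ a a' b b', ⟪tmul a b, N (tmul a' b')⟫_ℂ = s a a' * ⟪b, b'⟫_ℂ

theorem isLeftAmplification_map (Y : A →L[ℂ] A) :
    IsLeftAmplification (HilbertTensor.map Y (.id ℂ B)) :=
  ⟨fun a a' => ⟪a, Y a'⟫_ℂ, fun a a' b b' => by simp [map_tmul, inner_tmul]⟩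

theorem isLeftAmplification_of_subsingleton [Subsingleton A] (N : A ⊗ₕ B →L[ℂ] A ⊗ₕ B) :
    IsLeftAmplification N :=
  ⟨0, fun a a' b b' => by simp [Subsingleton.elim a 0, tmul_zero_left]⟩

theorem IsLeftAmplification.sub {N N' : A ⊗ₕ B →L[ℂ] A ⊗ₕ B} (h : IsLeftAmplification N)
    (h' : IsLeftAmplification N') : IsLeftAmplification (N - N') := by
  obtain ⟨s, hs⟩ := h
  obtain ⟨s', hs'⟩ := h'
  exact ⟨s - s', fun a a' b b' => by simp [inner_sub_right, hs, hs', sub_mul]⟩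

/-- `Y` is the compression of `N` by `a ↦ a ⊗ b₀` for a unit vector `b₀`. As this embedding is a
contraction, `‖Y‖ ≤ ‖N‖`, which later gives the uniform bound required of families in the atomic
algebra. -/
theorem IsLeftAmplification.exists_eq_map [CompleteSpace A] [CompleteSpace B] {N : A ⊗ₕ B →L[ℂ] A ⊗ₕ B}
    (h : IsLeftAmplification N) :
    ∃ Y : A →L[ℂ] A, ‖Y‖ ≤ ‖N‖ ∧ N = HilbertTensor.map Y (.id ℂ B) := by
  obtain ⟨s, hs⟩ := h
  obtain ⟨b₀, hb, hb'⟩ := exists_norm_le_one_unit B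
  have key : ∀ b b' : B, ⟪b₀, b₀⟫_ℂ * ⟪b, b'⟫_ℂ = ⟪b, b'⟫_ℂ := by
    intro b b'
    rcases subsingleton_or_nontrivial B with hB | hB
    · simp [Subsingleton.elim b 0]
    · simp [inner_self_eq_norm_sq_to_K, hb' hB]
  let J : A →L[ℂ] A ⊗ₕ B := (tmulL A B).flip b₀
  have hJ : ‖J‖ ≤ 1 := ContinuousLinearMap.opNorm_le_bound _ zero_le_one fun a => by
    simp only [J, ContinuousLinearMap.flip_apply, tmulL_apply, norm_tmul]
    nlinarith [norm_nonneg a]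
  refine ⟨J† ∘L N ∘L J, ?_, clm_ext_inner fun a b a' b' => ?_⟩
  · refine (ContinuousLinearMap.opNorm_comp_le _ _).trans ?_
    have h1 : ‖J†‖ ≤ 1 := by rwa [LinearIsometryEquiv.norm_map]
    have h2 := ContinuousLinearMap.opNorm_comp_le N J
    have h3 : ‖N‖ * ‖J‖ ≤ ‖N‖ * 1 := by gcongr
    have h4 : ‖J†‖ * ‖N ∘L J‖ ≤ 1 * ‖N ∘L J‖ := mul_le_mul_of_nonneg_right h1 (norm_nonneg (N ∘L J))
    linarith
  · rw [map_tmul, inner_tmul, hs]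
    simp only [ContinuousLinearMap.comp_apply, ContinuousLinearMap.adjoint_inner_right,
      ContinuousLinearMap.coe_id', id_eq]
    simp only [J, ContinuousLinearMap.flip_apply, tmulL_apply]
    rw [hs, mul_assoc, key]

/-- Rank one choices of `Y` turn identities for `Y ⊗ 1` into identities for slices; this is how the
generator condition is polarised. -/
theorem map_rankOne_id [CompleteSpace B] (x y : A) (z : A ⊗ₕ B) :
    HilbertTensor.map (rankOne ℂ x y) (.id ℂ B) z = tmul x (slice B y z) :=
  DFunLike.congr_fun (clm_ext (S := HilbertTensor.map (rankOne ℂ x y) (.id ℂ B))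
    (T := tmulL A B x ∘L slice B y) fun a b => by
      simp [map_tmul, slice_tmul, tmul_smul_left]) z

theorem map_comp_id_apply (X Y : A →L[ℂ] A) (z : A ⊗ₕ B) :
    HilbertTensor.map (X ∘L Y) (.id ℂ B) z =
      HilbertTensor.map X (.id ℂ B) (HilbertTensor.map Y (.id ℂ B) z) := by
  rw [map_comp_apply, ContinuousLinearMap.id_comp]

variable [CompleteSpace B] [CompleteSpace G]

/-- If `N† (Y ⊗ 1) N - M† (Y ⊗ 1) - (Y ⊗ 1) M` lies in `L(A) ⊗ 1` for all `Y` and a diagonal slice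
of `N` vanishes, then already `N† (Y ⊗ 1) N` lies in `L(A) ⊗ 1`. -/
theorem isLeftAmplification_conj {N : A ⊗ₕ B →L[ℂ] A ⊗ₕ G} {M : A ⊗ₕ B →L[ℂ] A ⊗ₕ B} {a₀ : A}
    (ha₀ : Nontrivial A → ‖a₀‖ = 1) (hN : ∀ b, slice G a₀ (N (tmul a₀ b)) = 0)
    (h : ∀ Y : A →L[ℂ] A, IsLeftAmplification (N† ∘L HilbertTensor.map Y (.id ℂ G) ∘L N -
      M† ∘L HilbertTensor.map Y (.id ℂ B) - HilbertTensor.map Y (.id ℂ B) ∘L M))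
    (Z : A →L[ℂ] A) : IsLeftAmplification (N† ∘L HilbertTensor.map Z (.id ℂ G) ∘L N) := by
  rcases subsingleton_or_nontrivial A with hA | hA
  · exact isLeftAmplification_of_subsingleton _
  have h1 : ⟪a₀, a₀⟫_ℂ = 1 := by simp [inner_self_eq_norm_sq_to_K, ha₀ hA]
  have hN' : ∀ b c, ⟪N (tmul a₀ b), tmul a₀ c⟫_ℂ = 0 := fun b c => by
    rw [← inner_conj_symm, ← inner_slice, hN, inner_zero_right, map_zero]
  choose s hs using h
  simp only [sub_apply, ContinuousLinearMap.comp_apply, inner_sub_right,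
    ContinuousLinearMap.adjoint_inner_right] at hs
  -- The four evaluations are arranged so that every term containing `M` occurs twice with opposite
  -- signs. In the last three, the `N` term carries a slice of `N (a₀ ⊗ ·)` at `a₀` and vanishes.
  -- Only `N† (Z ⊗ 1) N` at `(a, a')` survives.
  refine ⟨fun a a' => s Z a a' - s (Z ∘L rankOne ℂ a' a₀) a a₀ - s (rankOne ℂ a₀ a ∘L Z) a₀ a' +
    s (rankOne ℂ a₀ a ∘L Z ∘L rankOne ℂ a' a₀) a₀ a₀, fun a a' b b' => ?_⟩
  have e1 := hs Z a a' b b'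
  have e2 := hs (Z ∘L rankOne ℂ a' a₀) a a₀ b b'
  have e3 := hs (rankOne ℂ a₀ a ∘L Z) a₀ a' b b'
  have e4 := hs (rankOne ℂ a₀ a ∘L Z ∘L rankOne ℂ a' a₀) a₀ a₀ b b'
  simp only [map_comp_id_apply, map_rankOne_id, map_tmul, rankOne_apply, hN, h1,
    inner_tmul, tmul_zero_right, map_zero, inner_zero_right, hN', ContinuousLinearMap.comp_apply,
    inner_slice, one_smul, one_mul, ContinuousLinearMap.coe_id', id_eq, tmul_smul_left,
    inner_smul_right, zero_sub] at e1 e2 e3 e4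
  simp only [ContinuousLinearMap.comp_apply, ContinuousLinearMap.adjoint_inner_right]
  linear_combination e1 - e2 - e3 + e4

/-- If `M† (Y ⊗ 1) + (Y ⊗ 1) M` lies in `L(A) ⊗ 1` for all `Y`, then `M` lies in `L(A) ⊗ 1` up to
an antiselfadjoint operator `1 ⊗ i h`. -/
theorem exists_map_add_map [CompleteSpace A] {M : A ⊗ₕ B →L[ℂ] A ⊗ₕ B}
    (h : ∀ Y : A →L[ℂ] A, IsLeftAmplification
      (M† ∘L HilbertTensor.map Y (.id ℂ B) + HilbertTensor.map Y (.id ℂ B) ∘L M)) :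
    ∃ (k : A →L[ℂ] A) (g : B →L[ℂ] B), ‖k‖ ≤ 2 * ‖M‖ ∧ ‖g‖ ≤ ‖M‖ ∧ IsSelfAdjoint g ∧
      M = HilbertTensor.map k (.id ℂ B) + Complex.I • HilbertTensor.map (.id ℂ A) g := by
  obtain ⟨a₀, ha, ha'⟩ := exists_norm_le_one_unit A
  let J : B →L[ℂ] A ⊗ₕ B := tmulL A B a₀
  have hJ : ‖J‖ ≤ 1 := ContinuousLinearMap.opNorm_le_bound _ zero_le_one fun b => by
    simp only [J, tmulL_apply, norm_tmul]
    gcongr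
  let m : B →L[ℂ] B := J† ∘L M ∘L J
  have hm : ‖m‖ ≤ ‖M‖ := by
    refine (ContinuousLinearMap.opNorm_comp_le _ _).trans ?_
    have h1 : ‖J†‖ ≤ 1 := by rwa [LinearIsometryEquiv.norm_map]
    have h2 := ContinuousLinearMap.opNorm_comp_le M J
    have h3 : ‖M‖ * ‖J‖ ≤ ‖M‖ * 1 := by gcongr
    have h4 : ‖J†‖ * ‖M ∘L J‖ ≤ 1 * ‖M ∘L J‖ := by gcongr
    linarith
  have hmi : ∀ b b', ⟪b, m b'⟫_ℂ = ⟪tmul a₀ b, M (tmul a₀ b')⟫_ℂ := fun b b' => by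
    simp [m, J, ContinuousLinearMap.adjoint_inner_right]
  -- `g` is the imaginary part of the compression `m` of `M` to `a₀ ⊗ B`.
  let g : B →L[ℂ] B := (-Complex.I / 2) • (m - m†)
  have hg : ‖g‖ ≤ ‖M‖ := by
    have h1 : ‖m†‖ = ‖m‖ := LinearIsometryEquiv.norm_map _ _
    have h2 := norm_sub_le m (m†)
    rw [norm_smul]
    simp only [norm_div, norm_neg, Complex.norm_I, Complex.norm_ofNat]
    linarith
  have hgs : IsSelfAdjoint g := by
    rw [ContinuousLinearMap.isSelfAdjoint_iff']
    simp only [g, map_smulₛₗ, map_sub, ContinuousLinearMap.adjoint_adjoint]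
    simp only [map_div₀, map_neg, Complex.conj_I, map_ofNat]
    module
  have hgb : ‖HilbertTensor.map (.id ℂ A) g‖ ≤ ‖M‖ := (norm_map_id_left_le g).trans hg
  suffices hN : IsLeftAmplification (M - Complex.I • HilbertTensor.map (.id ℂ A) g) by
    obtain ⟨k, hk, hk'⟩ := hN.exists_eq_map
    refine ⟨k, g, hk.trans ?_, hg, hgs, by rw [← hk']; abel⟩
    have h1 := norm_sub_le M (Complex.I • HilbertTensor.map (.id ℂ A) g)
    have h2 := ContinuousLinearMap.opNorm_smul_le Complex.I (HilbertTensor.map (.id ℂ A) g)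
    rw [Complex.norm_I, one_mul] at h2
    linarith
  rcases subsingleton_or_nontrivial A with hA | hA
  · exact isLeftAmplification_of_subsingleton _
  have h1 : ⟪a₀, a₀⟫_ℂ = 1 := by simp [inner_self_eq_norm_sq_to_K, ha' hA]
  choose s hs using h
  simp only [add_apply, ContinuousLinearMap.comp_apply, inner_add_right,
    ContinuousLinearMap.adjoint_inner_right] at hs
  have hgi : ∀ b b', ⟪b, g b'⟫_ℂ = (-Complex.I / 2) * (⟪tmul a₀ b, M (tmul a₀ b')⟫_ℂ -
      ⟪M (tmul a₀ b), tmul a₀ b'⟫_ℂ) := fun b b' => by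
    simp only [g, smul_apply, sub_apply, inner_smul_right, inner_sub_right,
      ContinuousLinearMap.adjoint_inner_right, hmi]
    rw [← inner_conj_symm (m b) b', hmi, inner_conj_symm]
  refine ⟨fun a a' => s (rankOne ℂ a₀ a) a₀ a' - (1 / 2) * ⟪a, a'⟫_ℂ * s (rankOne ℂ a₀ a₀) a₀ a₀,
    fun a a' b b' => ?_⟩
  -- `e1` expresses `M` between `a` and `a'` as a scalar minus `⟨a, a'⟩ m†`. `e2` says that `m + m†`
  -- is a scalar, so `-m†` equals `i g` up to a scalar.
  have e1 := hs (rankOne ℂ a₀ a) a₀ a' b b'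
  have e2 := hs (rankOne ℂ a₀ a₀) a₀ a₀ b b'
  simp only [map_rankOne_id, slice_tmul, h1, inner_tmul, one_smul, one_mul, inner_slice,
    tmul_smul_right, inner_smul_right] at e1 e2
  simp only [sub_apply, inner_sub_right, smul_apply, inner_smul_right, map_tmul,
    inner_tmul, hgi, ContinuousLinearMap.coe_id', id_eq]
  linear_combination e1 - (1 / 2) * ⟪a, a'⟫_ℂ * e2 + (1 / 2) * ⟪a, a'⟫_ℂ *
    (⟪tmul a₀ b, M (tmul a₀ b')⟫_ℂ - ⟪M (tmul a₀ b), tmul a₀ b'⟫_ℂ) * Complex.I_sq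

end LeftAmplification

/-! ### Factorization of operators into semilocal form. -/

noncomputable section Factorization

open HilbertTensor InnerProductSpace

theorem Submodule.topologicalClosure_span_induction {X : Type*} [NormedAddCommGroup X]
    [NormedSpace ℂ X] {S : Set X} {p : X → Prop} (mem : ∀ x ∈ S, p x) (zero : p 0)
    (add : ∀ x y, p x → p y → p (x + y)) (smul : ∀ (c : ℂ) x, p x → p (c • x))
    (closed : IsClosed {x | p x}) {x : X} (hx : x ∈ (Submodule.span ℂ S).topologicalClosure) :
    p x := by
  let N : Submodule ℂ X :=
    { carrier := {x | p x}, add_mem' := add _ _, zero_mem' := zero, smul_mem' := smul }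
  exact Submodule.topologicalClosure_minimal (Submodule.span ℂ S) (t := N)
    (Submodule.span_le.2 mem) closed hx

theorem Orthonormal.countable_index {ι X : Type*} [NormedAddCommGroup X] [InnerProductSpace ℂ X]
    [TopologicalSpace.SeparableSpace X] {v : ι → X} (hv : Orthonormal ℂ v) : Countable ι := by
  -- Orthonormal vectors are at distance `√2`, so balls of radius `1/2` around them are disjoint; in
  -- a separable space there are only countably many.
  refine Pairwise.countable_of_isOpen_disjoint (s := fun i => Metric.ball (v i) (1 / 2)) ?_
    (fun i => Metric.isOpen_ball) fun i => Metric.nonempty_ball.2 one_half_pos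
  intro i j hij
  refine Set.disjoint_left.2 fun x hi hj => ?_
  rw [Metric.mem_ball, dist_eq_norm] at hi hj
  have h1 : ‖v i - v j‖ < 1 := by
    have := norm_sub_le (x - v j) (x - v i)
    rw [sub_sub_sub_cancel_left] at this
    linarith
  have h2 := norm_sub_sq (𝕜 := ℂ) (v i) (v j)
  rw [hv.2 hij, hv.1 i, hv.1 j] at h2
  norm_num at h2
  nlinarith [norm_nonneg (v i - v j)]

/-- A separable Hilbert space is `ℓ²` over a set of natural numbers, and this index set can be
lifted to any universe. The auxiliary spaces of the factorization can thus live in a universe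
prescribed in advance. -/
theorem exists_separable_linearIsometryEquiv (X : Type*) [NormedAddCommGroup X]
    [InnerProductSpace ℂ X] [CompleteSpace X] [TopologicalSpace.SeparableSpace X] :
    ∃ (F : Type uF) (_ : NormedAddCommGroup F) (_ : InnerProductSpace ℂ F) (_ : CompleteSpace F)
      (_ : TopologicalSpace.SeparableSpace F), Nonempty (F ≃ₗᵢ[ℂ] X) := by
  obtain ⟨w, b, hb⟩ := exists_hilbertBasis ℂ X
  have : Countable w := b.orthonormal.countable_index
  obtain ⟨f, hf⟩ := exists_injective_nat w
  let e : ULift.{uF} (Set.range f) ≃ w := Equiv.ulift.trans (Equiv.ofInjective f hf).symm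
  let b' : HilbertBasis (ULift.{uF} (Set.range f)) ℂ X :=
    HilbertBasis.mk (b.orthonormal.comp e e.injective) (by
      rw [EquivLike.range_comp b e, b.dense_span])
  refine ⟨lp (fun _ : ULift.{uF} (Set.range f) => ℂ) 2, inferInstance, inferInstance,
    inferInstance, ?_, ⟨b'.repr.symm⟩⟩
  exact b'.repr.surjective.denseRange.separableSpace b'.repr.continuous

variable {A A' B' G : Type*}
  [NormedAddCommGroup A] [InnerProductSpace ℂ A]
  [NormedAddCommGroup A'] [InnerProductSpace ℂ A']
  [NormedAddCommGroup B'] [InnerProductSpace ℂ B']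
  [NormedAddCommGroup G] [InnerProductSpace ℂ G] [CompleteSpace G]

/-- The partial matrix element `b ↦ (⟨a| ⊗ 1) T (a' ⊗ b)`. -/
def partialElement (T : A' ⊗ₕ B' →L[ℂ] A ⊗ₕ G) (p : A × A') : B' →L[ℂ] G :=
  slice G p.1 ∘L T ∘L tmulL A' B' p.2

theorem inner_partialElement {A'' B'' : Type*}
    [NormedAddCommGroup A''] [InnerProductSpace ℂ A'']
    [NormedAddCommGroup B''] [InnerProductSpace ℂ B'']
    (T : A' ⊗ₕ B' →L[ℂ] A ⊗ₕ G) (T' : A'' ⊗ₕ B'' →L[ℂ] A ⊗ₕ G) (p : A × A') (q : A × A'')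
    (b : B') (b' : B'') :
    ⟪partialElement T p b, partialElement T' q b'⟫_ℂ =
      ⟪tmul p.2 b, (T† ∘L HilbertTensor.map (rankOne ℂ p.1 q.1) (.id ℂ G) ∘L T')
        (tmul q.2 b')⟫_ℂ := by
  simp only [partialElement, ContinuousLinearMap.comp_apply, tmulL_apply,
    ContinuousLinearMap.adjoint_inner_right, map_rankOne_id]
  rw [← inner_conj_symm, inner_slice, inner_conj_symm]

/-- The closed span of the partial matrix elements of `T`. -/
def elementSpace (T : A' ⊗ₕ B' →L[ℂ] A ⊗ₕ G) : Submodule ℂ (B' →L[ℂ] G) :=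
  (Submodule.span ℂ (Set.range (partialElement T))).topologicalClosure

theorem partialElement_mem (T : A' ⊗ₕ B' →L[ℂ] A ⊗ₕ G) (p : A × A') :
    partialElement T p ∈ elementSpace T :=
  Submodule.le_topologicalClosure _ (Submodule.subset_span ⟨p, rfl⟩)

/-- For two partial matrix elements the inner product is a matrix element of `T† (|p⟩⟨q| ⊗ 1) T`,
hence a scalar times `⟨b, b'⟩`. Sesquilinearity and continuity carry this to the closed span, and
evaluation at the unit vector `b₀` identifies the scalar. -/
theorem inner_elementSpace {T : A' ⊗ₕ B' →L[ℂ] A ⊗ₕ G}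
    (hT : ∀ Z, IsLeftAmplification (T† ∘L HilbertTensor.map Z (.id ℂ G) ∘L T))
    {b₀ : B'} (hb₀ : Nontrivial B' → ‖b₀‖ = 1) {s t : B' →L[ℂ] G} (hs : s ∈ elementSpace T)
    (ht : t ∈ elementSpace T) (b b' : B') :
    ⟪s b, t b'⟫_ℂ = ⟪s b₀, t b₀⟫_ℂ * ⟪b, b'⟫_ℂ := by
  refine Submodule.topologicalClosure_span_induction
    (p := fun s => ⟪s b, t b'⟫_ℂ = ⟪s b₀, t b₀⟫_ℂ * ⟪b, b'⟫_ℂ) ?_ (by simp)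
    (fun x y hx hy => by simp [hx, hy, add_mul])
    (fun c x hx => by simp [hx]; ring)
    (isClosed_eq (by fun_prop) (by fun_prop)) hs
  rintro _ ⟨p, rfl⟩
  refine Submodule.topologicalClosure_span_induction
    (p := fun t => ⟪partialElement T p b, t b'⟫_ℂ =
      ⟪partialElement T p b₀, t b₀⟫_ℂ * ⟪b, b'⟫_ℂ) ?_ (by simp)
    (fun x y hx hy => by simp [hx, hy, add_mul])
    (fun c x hx => by simp [hx]; ring)
    (isClosed_eq (by fun_prop) (by fun_prop)) ht
  rintro _ ⟨q, rfl⟩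
  obtain ⟨σ, hσ⟩ := hT (rankOne ℂ p.1 q.1)
  rw [inner_partialElement, inner_partialElement, hσ, hσ]
  rcases subsingleton_or_nontrivial B' with hB | hB
  · simp [Subsingleton.elim b 0]
  · simp [inner_self_eq_norm_sq_to_K, hb₀ hB]

/-- An operator `T : A' ⊗ B' → A ⊗ G` for which every `T† (Z ⊗ 1) T` lies in `L(A') ⊗ 1` has the
form `(1 ⊗ U) (S ⊗ 1)` with an isometry `U`. -/
theorem exists_semilocal_factorization [CompleteSpace A'] [CompleteSpace B'] [TopologicalSpace.SeparableSpace G]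
    {T : A' ⊗ₕ B' →L[ℂ] A ⊗ₕ G}
    (hT : ∀ Z, IsLeftAmplification (T† ∘L HilbertTensor.map Z (.id ℂ G) ∘L T)) :
    ∃ (F : Type uF) (_ : NormedAddCommGroup F) (_ : InnerProductSpace ℂ F) (_ : CompleteSpace F)
      (_ : TopologicalSpace.SeparableSpace F) (S : A' →L[ℂ] A ⊗ₕ F) (U : F ⊗ₕ B' →L[ℂ] G),
      Isometry U ∧
      (∀ x, HilbertTensor.map (.id ℂ A) U
        (assoc A F B' (HilbertTensor.map S (.id ℂ B') x)) = T x) ∧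
      ∀ z, (∀ p b, ⟪partialElement T p b, z⟫_ℂ = 0) → ∀ w, ⟪U w, z⟫_ℂ = 0 := by
  obtain ⟨b₀, -, hb₀⟩ := exists_norm_le_one_unit B'
  have hin := fun {s t : B' →L[ℂ] G} (hs : s ∈ elementSpace T) (ht : t ∈ elementSpace T) =>
    inner_elementSpace hT hb₀ hs ht
  -- With both arguments equal, `hin` gives `‖t b‖ = ‖t b₀‖ ‖b‖`: each `t` is a multiple of an
  -- isometry. Evaluation at `b₀` is therefore isometric and transports the Hilbert structure of `G`
  -- to the element space.
  have hnorm : ∀ t ∈ elementSpace T, ‖t b₀‖ = ‖t‖ := by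
    intro t ht
    refine le_antisymm ?_ (t.opNorm_le_bound (norm_nonneg _) fun b => ?_)
    · rcases subsingleton_or_nontrivial B' with hB | hB
      · simp [Subsingleton.elim b₀ 0]
      · simpa [hb₀ hB] using t.le_opNorm b₀
    · have h := hin ht ht b b
      simp only [inner_self_eq_norm_sq_to_K] at h
      norm_cast at h
      rw [← mul_pow] at h
      exact (pow_left_inj₀ (norm_nonneg _) (by positivity) two_ne_zero).1 h |>.le
  let ev : elementSpace T →ₗᵢ[ℂ] G :=
    { toLinearMap := (ContinuousLinearMap.apply ℂ G b₀).toLinearMap ∘ₗ (elementSpace T).subtype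
      norm_map' := fun t => hnorm t t.2 }
  have : CompleteSpace (elementSpace T) :=
    (Submodule.isClosed_topologicalClosure _).completeSpace_coe
  have hcr : IsComplete (Set.range ev) :=
    (completeSpace_iff_isComplete_range ev.isometry.isUniformInducing).1 inferInstance
  have : CompleteSpace (LinearMap.range ev.toLinearMap) := hcr.completeSpace_coe
  obtain ⟨F, i₁, i₂, i₃, i₄, ⟨φ⟩⟩ :=
    (exists_separable_linearIsometryEquiv (LinearMap.range ev.toLinearMap) : ∃ _ : Type uF, _)
  let e : F →ₗ[ℂ] B' →L[ℂ] G := (elementSpace T).subtype ∘ₗ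
    (φ.trans ev.equivRange.symm).toLinearEquiv.toLinearMap
  have he : ∀ f, e f ∈ elementSpace T := fun f => (ev.equivRange.symm (φ f)).2
  have heb : ∀ f, e f b₀ = (φ f : G) := fun f =>
    congrArg Subtype.val (ev.equivRange.apply_symm_apply (φ f))
  have hsurj : ∀ t ∈ elementSpace T, ∃ f, e f = t := fun t ht =>
    ⟨φ.symm (ev.equivRange ⟨t, ht⟩), by simp [e]⟩
  let J : F →ₗᵢ[ℂ] G := (LinearMap.range ev.toLinearMap).subtypeₗᵢ.comp φ.toLinearIsometry
  have hJ : ∀ f, J f = e f b₀ := fun f => (heb f).symm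
  -- `U (f ⊗ b)` is the operator represented by `f` applied to `b`; isometry is exactly the product
  -- formula `hin`.
  obtain ⟨U, hU, hUe⟩ := exists_lift_isometry e fun f b f' b' => by
    rw [hin (he f) (he f') b b', ← hJ, ← hJ, J.inner_map_map]
  -- `S` is chosen so that its slice at `c`, applied to `a'`, is the vector `f` representing
  -- `partialElement T (c, a')`.
  let S : A' →L[ℂ] A ⊗ₕ F :=
    HilbertTensor.map (.id ℂ A) (J.toContinuousLinearMap†) ∘L T ∘L (tmulL A' B').flip b₀
  refine ⟨F, i₁, i₂, i₃, i₄, S, U, hU, fun x => ?_, fun z hz w => ?_⟩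
  · refine DFunLike.congr_fun (clm_ext (S := HilbertTensor.map (.id ℂ A) U ∘L
      ((assoc A F B').toContinuousLinearEquiv : (A ⊗ₕ F) ⊗ₕ B' →L[ℂ] A ⊗ₕ (F ⊗ₕ B')) ∘L
        HilbertTensor.map S (.id ℂ B')) (T := T) fun a' b => ext_slice fun c => ?_) x
    obtain ⟨f, hf⟩ := hsurj _ (partialElement_mem T (c, a'))
    have hS : slice F c (S a') = f := by
      have : slice G c (T (tmul a' b₀)) = J f := by rw [hJ, hf]; rfl
      simp only [S, ContinuousLinearMap.comp_apply, ContinuousLinearMap.flip_apply, tmulL_apply]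
      rw [slice_map_id_left, this]
      refine ext_inner_left ℂ fun v => ?_
      rw [ContinuousLinearMap.adjoint_inner_right]
      exact J.inner_map_map v f
    simp only [ContinuousLinearMap.comp_apply, map_tmul]
    rw [slice_map_id_left]
    change U (slice (F ⊗ₕ B') c (assoc A F B' _)) = _
    rw [slice_assoc, map_tmul, hS, hUe, hf]
    rfl
  · have h0 : (innerSL ℂ z) ∘L U = 0 := clm_ext fun f b => by
      simp only [ContinuousLinearMap.comp_apply, innerSL_apply_apply, hUe, zero_apply]
      rw [← inner_conj_symm, map_eq_zero]
      exact Submodule.topologicalClosure_span_induction (p := fun t => ⟪t b, z⟫_ℂ = 0)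
        (by rintro _ ⟨p, rfl⟩; exact hz p b) (by simp)
        (fun x y hx hy => by simp [hx, hy])
        (fun c x hx => by simp [hx])
        (isClosed_eq (by fun_prop) (by fun_prop)) (he f)
    rw [← inner_conj_symm, map_eq_zero]
    exact DFunLike.congr_fun h0 w

/-- The isometries of the factorizations of several operators `T j` with `(T i)† (Z ⊗ 1) T j = 0`
for `i ≠ j` can be chosen with orthogonal ranges. -/
theorem exists_semilocal_factorization_family {ι : Type*} {A' B' : ι → Type*}
    [∀ i, NormedAddCommGroup (A' i)] [∀ i, InnerProductSpace ℂ (A' i)] [∀ i, CompleteSpace (A' i)]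
    [∀ i, NormedAddCommGroup (B' i)] [∀ i, InnerProductSpace ℂ (B' i)] [∀ i, CompleteSpace (B' i)]
    [TopologicalSpace.SeparableSpace G] {T : ∀ i, A' i ⊗ₕ B' i →L[ℂ] A ⊗ₕ G}
    (hT : ∀ i Z, IsLeftAmplification ((T i)† ∘L HilbertTensor.map Z (.id ℂ G) ∘L T i))
    (hT' : ∀ i j, i ≠ j → ∀ Z, (T i)† ∘L HilbertTensor.map Z (.id ℂ G) ∘L T j = 0) :
    ∃ (F : ι → Type uF) (_ : ∀ i, NormedAddCommGroup (F i)) (_ : ∀ i, InnerProductSpace ℂ (F i))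
      (_ : ∀ i, CompleteSpace (F i)) (_ : ∀ i, TopologicalSpace.SeparableSpace (F i))
      (S : ∀ i, A' i →L[ℂ] A ⊗ₕ F i) (U : ∀ i, F i ⊗ₕ B' i →L[ℂ] G),
      (∀ i, Isometry (U i)) ∧
      (∀ i x, HilbertTensor.map (.id ℂ A) (U i)
        (assoc A (F i) (B' i) (HilbertTensor.map (S i) (.id ℂ (B' i)) x)) = T i x) ∧
      ∀ i j, i ≠ j → (U i)† ∘L U j = 0 := by
  choose F i₁ i₂ i₃ i₄ S U hU hS hz using fun i =>
    (exists_semilocal_factorization (hT i) : ∃ _ : Type uF, _)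
  refine ⟨F, i₁, i₂, i₃, i₄, S, U, hU, hS, fun i j hij => ?_⟩
  ext1 w
  refine ext_inner_left ℂ fun v => ?_
  rw [ContinuousLinearMap.comp_apply, ContinuousLinearMap.adjoint_inner_right, zero_apply,
    inner_zero_right]
  -- The vectors `partialElement T p b` control the range of each `U`, so it suffices to test
  -- orthogonality on them, once for `i` and once for `j`.
  refine hz i _ (fun p b => ?_) v
  rw [← inner_conj_symm, map_eq_zero]
  refine hz j _ (fun q b' => ?_) w
  rw [inner_partialElement, hT' j i hij.symm]
  simp

end Factorization

/-! ### Orthogonal resolutions and block diagonal operators. -/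

noncomputable section Resolution

theorem norm_sq_sum_of_pairwise_orthogonal {ι E : Type*} [NormedAddCommGroup E]
    [InnerProductSpace ℂ E] {f : ι → E} (hf : Pairwise fun i j => ⟪f i, f j⟫_ℂ = 0)
    (s : Finset ι) : ‖∑ i ∈ s, f i‖ ^ 2 = ∑ i ∈ s, ‖f i‖ ^ 2 := by
  classical
  induction s using Finset.induction_on with
  | empty => simp
  | insert a s ha ih =>
    rw [Finset.sum_insert ha, Finset.sum_insert ha, ← ih]
    have h0 : ⟪f a, ∑ i ∈ s, f i⟫_ℂ = 0 := by
      rw [inner_sum]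
      exact Finset.sum_eq_zero fun i hi => hf fun h => ha (h ▸ hi)
    have := norm_add_sq_eq_norm_sq_add_norm_sq_of_inner_eq_zero (𝕜 := ℂ) _ _ h0
    nlinarith

theorem summable_of_pairwise_orthogonal {ι E : Type*} [NormedAddCommGroup E]
    [InnerProductSpace ℂ E] [CompleteSpace E] {f : ι → E}
    (hf : Pairwise fun i j => ⟪f i, f j⟫_ℂ = 0) (h : Summable fun i => ‖f i‖ ^ 2) :
    Summable f := by
  -- The lines spanned by the `f i` form an orthogonal family, for which summability is equivalent
  -- to square summability of norms.
  have hV : OrthogonalFamily ℂ (fun i => (ℂ ∙ f i)) fun i => (ℂ ∙ f i).subtypeₗᵢ := by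
    rintro i j hij ⟨x, hx⟩ ⟨y, hy⟩
    obtain ⟨c, rfl⟩ := Submodule.mem_span_singleton.1 hx
    obtain ⟨d, rfl⟩ := Submodule.mem_span_singleton.1 hy
    simp [inner_smul_left, inner_smul_right, hf hij]
  exact (hV.summable_iff_norm_sq_summable
    fun i => ⟨f i, Submodule.mem_span_singleton_self (f i)⟩).2 h

variable {I : Type*} {H H₀ H' H₀' : Type*} {Hs Hs' : I → Type*}
  [NormedAddCommGroup H] [InnerProductSpace ℂ H] [CompleteSpace H]
  [NormedAddCommGroup H₀] [InnerProductSpace ℂ H₀] [CompleteSpace H₀]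
  [∀ i, NormedAddCommGroup (Hs i)] [∀ i, InnerProductSpace ℂ (Hs i)] [∀ i, CompleteSpace (Hs i)]
  [NormedAddCommGroup H'] [InnerProductSpace ℂ H'] [CompleteSpace H']
  [NormedAddCommGroup H₀'] [InnerProductSpace ℂ H₀'] [CompleteSpace H₀']
  [∀ i, NormedAddCommGroup (Hs' i)] [∀ i, InnerProductSpace ℂ (Hs' i)]
  [∀ i, CompleteSpace (Hs' i)]

/-- The operators `P₀ : H → H₀` and `P i : H → Hs i` are the coordinate maps of an orthogonal
decomposition `H ≃ H₀ ⊕ ⨁ i, Hs i`. -/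
structure IsOrthogonalResolution (P₀ : H →L[ℂ] H₀) (P : ∀ i, H →L[ℂ] Hs i) : Prop where
  zero_zero : ∀ y, P₀ ((P₀†) y) = y
  zero_block : ∀ i y, P₀ (((P i)†) y) = 0
  block_self : ∀ i y, P i (((P i)†) y) = y
  block_ne : ∀ i j, i ≠ j → ∀ y, P i (((P j)†) y) = 0
  eq_zero : ∀ x, P₀ x = 0 → (∀ i, P i x = 0) → x = 0

namespace IsOrthogonalResolution

variable {P₀ : H →L[ℂ] H₀} {P : ∀ i, H →L[ℂ] Hs i} (hP : IsOrthogonalResolution P₀ P)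
  {R₀ : H' →L[ℂ] H₀'} {R : ∀ i, H' →L[ℂ] Hs' i} (hR : IsOrthogonalResolution R₀ R)

include hP

theorem block_zero (i : I) (y : H₀) : P i ((P₀†) y) = 0 :=
  ext_inner_left ℂ fun v => by
    rw [← ContinuousLinearMap.adjoint_inner_left, ContinuousLinearMap.adjoint_inner_right,
      hP.zero_block, inner_zero_left, inner_zero_right]

theorem eq_of_forall {x y : H} (h₀ : P₀ x = P₀ y) (h : ∀ i, P i x = P i y) : x = y :=
  sub_eq_zero.1 (hP.eq_zero _ (by simp [h₀]) fun i => by simp [h])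

theorem norm_adjoint_apply (i : I) (y : Hs i) : ‖((P i)†) y‖ = ‖y‖ := by
  have h : ⟪((P i)†) y, ((P i)†) y⟫_ℂ = ⟪y, y⟫_ℂ := by
    rw [ContinuousLinearMap.adjoint_inner_left, hP.block_self]
  rw [inner_self_eq_norm_sq_to_K, inner_self_eq_norm_sq_to_K] at h
  norm_cast at h
  exact (pow_left_inj₀ (norm_nonneg _) (norm_nonneg _) two_ne_zero).1 h

theorem norm_adjoint_le (i : I) : ‖(P i)†‖ ≤ 1 :=
  ContinuousLinearMap.opNorm_le_bound _ zero_le_one fun y => by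
    rw [hP.norm_adjoint_apply, one_mul]

theorem norm_le (i : I) : ‖P i‖ ≤ 1 := by
  rw [← LinearIsometryEquiv.norm_map ContinuousLinearMap.adjoint]
  exact hP.norm_adjoint_le i

theorem inner_adjoint_adjoint_ne {i j : I} (hij : i ≠ j) (y : Hs i) (z : Hs j) :
    ⟪((P i)†) y, ((P j)†) z⟫_ℂ = 0 := by
  rw [ContinuousLinearMap.adjoint_inner_left, hP.block_ne i j hij, inner_zero_right]

theorem pairwise_orthogonal (y : ∀ i, Hs i) :
    Pairwise fun i j => ⟪((P i)†) (y i), ((P j)†) (y j)⟫_ℂ = 0 :=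
  fun _ _ hij => hP.inner_adjoint_adjoint_ne hij _ _

/-- Bessel's inequality: Cauchy–Schwarz for `x` and the partial sum `z`, where `⟨x, z⟩ = ‖z‖²`. -/
theorem sum_norm_sq_le (x : H) (s : Finset I) : ∑ i ∈ s, ‖P i x‖ ^ 2 ≤ ‖x‖ ^ 2 := by
  set z := ∑ i ∈ s, ((P i)†) (P i x) with hz
  have h1 : ‖z‖ ^ 2 = ∑ i ∈ s, ‖P i x‖ ^ 2 := by
    rw [hz, norm_sq_sum_of_pairwise_orthogonal (hP.pairwise_orthogonal fun i => P i x)]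
    simp [hP.norm_adjoint_apply]
  have h2 : ⟪x, z⟫_ℂ = ((∑ i ∈ s, ‖P i x‖ ^ 2 : ℝ) : ℂ) := by
    rw [hz, inner_sum]
    push_cast
    refine Finset.sum_congr rfl fun i _ => ?_
    rw [ContinuousLinearMap.adjoint_inner_right, inner_self_eq_norm_sq_to_K]
    rfl
  have h3 : ‖z‖ ^ 2 ≤ ‖x‖ * ‖z‖ := by
    have := norm_inner_le_norm (𝕜 := ℂ) x z
    rwa [h2, Complex.norm_real, ← h1, Real.norm_of_nonneg (by positivity)] at this
  rw [← h1]
  have h4 : ‖z‖ ≤ ‖x‖ := by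
    by_contra hlt
    push Not at hlt
    nlinarith [norm_nonneg x]
  gcongr

theorem summable_norm_sq (x : H) : Summable fun i => ‖P i x‖ ^ 2 :=
  summable_of_sum_le (fun _ => by positivity) (hP.sum_norm_sq_le x)

theorem hasSum (x : H) : HasSum (fun i => ((P i)†) (P i x)) (x - (P₀†) (P₀ x)) := by
  classical
  have hs : Summable fun i => ((P i)†) (P i x) :=
    summable_of_pairwise_orthogonal (hP.pairwise_orthogonal fun i => P i x)
      (by simpa [hP.norm_adjoint_apply] using hP.summable_norm_sq x)
  convert! hs.hasSum using 1
  refine hP.eq_of_forall ?_ fun j => ?_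
  · refine HasSum.unique (f := fun i => P₀ (((P i)†) (P i x))) ?_ (hs.hasSum.mapL P₀)
    simp [hP.zero_block, hP.zero_zero, hasSum_zero]
  · refine HasSum.unique (f := fun i => P j (((P i)†) (P i x))) ?_ (hs.hasSum.mapL (P j))
    have : P j (x - (P₀†) (P₀ x)) = P j (((P j)†) (P j x)) := by
      simp [hP.block_zero, hP.block_self]
    rw [this]
    exact hasSum_single j fun i hi => hP.block_ne j i hi.symm _

theorem clm_ext {X : Type*} [NormedAddCommGroup X] [NormedSpace ℂ X] {S T : H →L[ℂ] X}
    (h₀ : ∀ y, S ((P₀†) y) = T ((P₀†) y)) (h : ∀ i y, S (((P i)†) y) = T (((P i)†) y)) :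
    S = T := by
  ext1 x
  have h1 := (hP.hasSum x).mapL S
  have h2 := (hP.hasSum x).mapL T
  simp only [h] at h1
  have := h1.unique h2
  rwa [map_sub, map_sub, h₀, sub_left_inj] at this

theorem hasSum_inner (x y : H) (h : P₀ x = 0) :
    HasSum (fun i => ⟪P i x, P i y⟫_ℂ) ⟪x, y⟫_ℂ := by
  have h1 := (hP.hasSum y).mapL (innerSL ℂ x)
  simp only [innerSL_apply_apply, ContinuousLinearMap.adjoint_inner_right, inner_sub_right, h,
    inner_zero_left, sub_zero] at h1
  exact h1

include hR

/-- A uniform bound on the blocks makes the mutually orthogonal terms square summable, with the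
bound `C` for the sum. This is why norm estimates accompany the pieces constructed for each block.
-/
theorem exists_blockDiagonal {D : ∀ i, Hs i →L[ℂ] Hs' i} {C : ℝ} (hD : ∀ i, ‖D i‖ ≤ C) :
    ∃ T : H →L[ℂ] H', SOTHasSum (fun i => (R i)† ∘L D i ∘L P i) T := by
  -- Without an index, nothing forces `C` to be nonnegative.
  rcases isEmpty_or_nonempty I with hI | ⟨⟨i₀⟩⟩
  · exact ⟨0, fun x => by simp [hasSum_empty]⟩
  have hC : 0 ≤ C := (norm_nonneg _).trans (hD i₀)
  have horth : ∀ x, Pairwise fun i j => ⟪((R i)†) (D i (P i x)), ((R j)†) (D j (P j x))⟫_ℂ = 0 :=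
    fun x => hR.pairwise_orthogonal _
  have hle : ∀ x i, ‖((R i)†) (D i (P i x))‖ ^ 2 ≤ C ^ 2 * ‖P i x‖ ^ 2 := fun x i => by
    rw [hR.norm_adjoint_apply, ← mul_pow]
    have := (D i).le_of_opNorm_le (hD i) (P i x)
    gcongr
  have hs : ∀ x, Summable fun i => ((R i)†) (D i (P i x)) := fun x =>
    summable_of_pairwise_orthogonal (horth x)
      (Summable.of_nonneg_of_le (fun _ => by positivity) (hle x)
        ((hP.summable_norm_sq x).mul_left _))
  let T : H →ₗ[ℂ] H' :=
    { toFun := fun x => ∑' i, ((R i)†) (D i (P i x))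
      map_add' := fun x y => by simp only [map_add]; exact (hs x).tsum_add (hs y)
      map_smul' := fun c x => by simp only [map_smul, RingHom.id_apply]; exact (hs x).tsum_const_smul c }
  refine ⟨T.mkContinuous C fun x => ?_, fun x => (hs x).hasSum⟩
  have hlim : Filter.Tendsto (fun s : Finset I => ‖∑ i ∈ s, ((R i)†) (D i (P i x))‖)
      Filter.atTop (nhds ‖T x‖) := (hs x).hasSum.norm
  refine le_of_tendsto' hlim fun s => ?_
  refine (pow_le_pow_iff_left₀ (norm_nonneg _) (by positivity) two_ne_zero).1 ?_
  rw [norm_sq_sum_of_pairwise_orthogonal (horth x), mul_pow]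
  calc _ ≤ ∑ i ∈ s, C ^ 2 * ‖P i x‖ ^ 2 := Finset.sum_le_sum fun i _ => hle x i
    _ = C ^ 2 * ∑ i ∈ s, ‖P i x‖ ^ 2 := by rw [Finset.mul_sum]
    _ ≤ C ^ 2 * ‖x‖ ^ 2 := by gcongr; exact hP.sum_norm_sq_le x s

end IsOrthogonalResolution

end Resolution

/-! ### Strongly convergent double series of blocks. -/

noncomputable section BlockSeries

set_option linter.unusedSectionVars false

variable {I : Type*} {H H₀ H' H₀' : Type*} {Hs Hs' : I → Type*}
  [NormedAddCommGroup H] [InnerProductSpace ℂ H] [CompleteSpace H]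
  [NormedAddCommGroup H₀] [InnerProductSpace ℂ H₀] [CompleteSpace H₀]
  [∀ i, NormedAddCommGroup (Hs i)] [∀ i, InnerProductSpace ℂ (Hs i)] [∀ i, CompleteSpace (Hs i)]
  [NormedAddCommGroup H'] [InnerProductSpace ℂ H'] [CompleteSpace H']
  [NormedAddCommGroup H₀'] [InnerProductSpace ℂ H₀'] [CompleteSpace H₀']
  [∀ i, NormedAddCommGroup (Hs' i)] [∀ i, InnerProductSpace ℂ (Hs' i)]
  [∀ i, CompleteSpace (Hs' i)]

namespace IsOrthogonalResolution

variable {P₀ : H →L[ℂ] H₀} {P : ∀ i, H →L[ℂ] Hs i} (hP : IsOrthogonalResolution P₀ P)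
  {R₀ : H' →L[ℂ] H₀'} {R : ∀ i, H' →L[ℂ] Hs' i} (hR : IsOrthogonalResolution R₀ R)

include hP in
theorem apply_zero_of_sotHasSum₂ {D : ∀ i j, Hs j →L[ℂ] Hs' i} {T : H →L[ℂ] H'}
    (hT : SOTHasSum (fun p : I × I => (R p.1)† ∘L D p.1 p.2 ∘L P p.2) T) (y : H₀) :
    T ((P₀†) y) = 0 := by
  have h := hT ((P₀†) y)
  simp only [ContinuousLinearMap.comp_apply, hP.block_zero, map_zero] at h
  exact h.unique hasSum_zero

include hR

theorem zero_apply_of_sotHasSum {D : ∀ i, Hs i →L[ℂ] Hs' i} {T : H →L[ℂ] H'}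
    (hT : SOTHasSum (fun i => (R i)† ∘L D i ∘L P i) T) (x : H) : R₀ (T x) = 0 := by
  have h := (hT x).mapL R₀
  simp only [ContinuousLinearMap.comp_apply, hR.zero_block] at h
  exact h.unique hasSum_zero

theorem block_apply_of_sotHasSum {D : ∀ i, Hs i →L[ℂ] Hs' i} {T : H →L[ℂ] H'}
    (hT : SOTHasSum (fun i => (R i)† ∘L D i ∘L P i) T) (i : I) (x : H) :
    R i (T x) = D i (P i x) := by
  have h := (hT x).mapL (R i)
  simp only [ContinuousLinearMap.comp_apply] at h
  refine h.unique ?_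
  have := hasSum_single (f := fun j => R i (((R j)†) (D j (P j x)))) i
    fun j hj => hR.block_ne i j hj.symm _
  rwa [hR.block_self] at this

theorem zero_apply_of_sotHasSum₂ {D : ∀ i j, Hs j →L[ℂ] Hs' i} {T : H →L[ℂ] H'}
    (hT : SOTHasSum (fun p : I × I => (R p.1)† ∘L D p.1 p.2 ∘L P p.2) T) (x : H) :
    R₀ (T x) = 0 := by
  have h := (hT x).mapL R₀
  simp only [ContinuousLinearMap.comp_apply, hR.zero_block] at h
  exact h.unique hasSum_zero

include hP

theorem block_of_sotHasSum₂ {D : ∀ i j, Hs j →L[ℂ] Hs' i} {T : H →L[ℂ] H'}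
    (hT : SOTHasSum (fun p : I × I => (R p.1)† ∘L D p.1 p.2 ∘L P p.2) T) (i j : I) (y : Hs j) :
    R i (T (((P j)†) y)) = D i j y := by
  have h := (hT (((P j)†) y)).mapL (R i)
  simp only [ContinuousLinearMap.comp_apply] at h
  refine h.unique ?_
  have := hasSum_single (f := fun p : I × I =>
    R i (((R p.1)†) (D p.1 p.2 (P p.2 (((P j)†) y))))) (i, j) (by
      rintro ⟨k, l⟩ hkl
      by_cases hk : i = k
      · have hl : l ≠ j := fun hl => hkl (by rw [hk, hl])
        simp [hP.block_ne l j hl]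
      · exact hR.block_ne i k hk _)
  rwa [hR.block_self, hP.block_self] at this

/-- If the blocks of `T` in every row are pairwise orthogonal, then `T` (up to its null row) is the
unconditional sum of its blocks. -/
theorem sotHasSum_blocks {T : H →L[ℂ] H'} (hT₀ : ∀ i y, R i (T ((P₀†) y)) = 0)
    (hT : ∀ i j k, j ≠ k → ∀ y z, ⟪R i (T (((P j)†) y)), R i (T (((P k)†) z))⟫_ℂ = 0) :
    SOTHasSum (fun p : I × I => (R p.1)† ∘L (R p.1 ∘L T ∘L (P p.2)†) ∘L P p.2)
      (T - R₀† ∘L R₀ ∘L T) := by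
  intro x
  simp only [ContinuousLinearMap.comp_apply, sub_apply]
  set f : I × I → H' := fun p => ((R p.1)†) (R p.1 (T (((P p.2)†) (P p.2 x)))) with hf
  have hne : ∀ i j, i ≠ j → ∀ y, R i (((R j)†) y) = 0 := hR.block_ne
  have horth : Pairwise fun p q => ⟪f p, f q⟫_ℂ = 0 := by
    rintro ⟨i, j⟩ ⟨k, l⟩ hne
    by_cases hik : i = k
    · subst hik
      have hjl : j ≠ l := fun h => hne (by rw [h])
      simp only [hf, ContinuousLinearMap.adjoint_inner_left, hR.block_self]
      exact hT i j l hjl _ _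
    · exact hR.inner_adjoint_adjoint_ne hik _ _
  -- Orthogonality within row `i` turns the sum of squares into the squared norm of one component of
  -- `T` at a truncation of `x`. Bessel over the rows then bounds any rectangle by `(‖T‖ ‖x‖)²`.
  have hrow : ∀ i (t : Finset I), ∑ j ∈ t, ‖f (i, j)‖ ^ 2 =
      ‖R i (T (∑ j ∈ t, ((P j)†) (P j x)))‖ ^ 2 := fun i t => by
    have h1 : Pairwise fun j k => ⟪f (i, j), f (i, k)⟫_ℂ = 0 := fun j k hjk =>
      horth fun h => hjk (congrArg Prod.snd h)
    rw [← norm_sq_sum_of_pairwise_orthogonal h1, ← hR.norm_adjoint_apply]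
    simp only [hf, map_sum]
  have hPx : ∀ t : Finset I, ‖∑ j ∈ t, ((P j)†) (P j x)‖ ≤ ‖x‖ := fun t => by
    refine (pow_le_pow_iff_left₀ (norm_nonneg _) (norm_nonneg _) two_ne_zero).1 ?_
    rw [norm_sq_sum_of_pairwise_orthogonal (hP.pairwise_orthogonal fun i => P i x)]
    simpa [hP.norm_adjoint_apply] using hP.sum_norm_sq_le x t
  have hsum : Summable f := by
    classical
    refine summable_of_pairwise_orthogonal horth
      (summable_of_sum_le (c := (‖T‖ * ‖x‖) ^ 2) (fun _ => by positivity) fun u => ?_)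
    calc ∑ p ∈ u, ‖f p‖ ^ 2
        -- An arbitrary finite set of pairs is enlarged to a rectangle, where rows can be summed
        -- separately.
        ≤ ∑ p ∈ u.image Prod.fst ×ˢ u.image Prod.snd, ‖f p‖ ^ 2 :=
          Finset.sum_le_sum_of_subset_of_nonneg Finset.subset_product fun _ _ _ => by positivity
      _ = ∑ i ∈ u.image Prod.fst, ‖R i (T (∑ j ∈ u.image Prod.snd, ((P j)†) (P j x)))‖ ^ 2 := by
          rw [Finset.sum_product]
          exact Finset.sum_congr rfl fun i _ => hrow i _
      _ ≤ ‖T (∑ j ∈ u.image Prod.snd, ((P j)†) (P j x))‖ ^ 2 := hR.sum_norm_sq_le _ _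
      _ ≤ (‖T‖ * ‖x‖) ^ 2 := by
          gcongr
          exact T.le_opNorm_of_le (hPx _)
  convert! hsum.hasSum using 1
  refine hR.eq_of_forall ?_ fun i => ?_
  · refine HasSum.unique (f := fun p => R₀ (f p)) ?_ (hsum.hasSum.mapL R₀)
    simp [hf, hR.zero_block, hR.zero_zero, hasSum_zero]
  · have h1 := hsum.hasSum.mapL (R i)
    have h2 : HasSum (fun j => R i (f (i, j))) (R i (T x)) := by
      have := ((hP.hasSum x).mapL T).mapL (R i)
      rw [map_sub, map_sub, hT₀, sub_zero] at this
      simpa only [hf, hR.block_self] using this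
    have hinj : Function.Injective fun j : I => (i, j) := fun _ _ h => congrArg Prod.snd h
    have h3 := (hinj.hasSum_iff (f := fun p => R i (f p)) (by
      rintro ⟨k, l⟩ hkl
      exact hne i k (fun h => hkl ⟨l, by rw [h]⟩) _)).1 h2
    rw [map_sub, hR.block_zero, sub_zero]
    exact h3.unique h1

end IsOrthogonalResolution

end BlockSeries

/-! ### The atomic algebra in terms of blocks. -/

noncomputable section AtomicAlgebra

open HilbertTensor

set_option linter.unusedSectionVars false

theorem HilbertTensor.adjoint_map_id {E E' F : Type*}
    [NormedAddCommGroup E] [InnerProductSpace ℂ E] [CompleteSpace E]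
    [NormedAddCommGroup E'] [InnerProductSpace ℂ E'] [CompleteSpace E']
    [NormedAddCommGroup F] [InnerProductSpace ℂ F] [CompleteSpace F] (f : E →L[ℂ] E') :
    (HilbertTensor.map f (.id ℂ F))† = HilbertTensor.map (f†) (.id ℂ F) := by
  rw [adjoint_map, adjoint_id]

theorem HilbertTensor.adjoint_id_map {E F F' : Type*}
    [NormedAddCommGroup E] [InnerProductSpace ℂ E] [CompleteSpace E]
    [NormedAddCommGroup F] [InnerProductSpace ℂ F] [CompleteSpace F]
    [NormedAddCommGroup F'] [InnerProductSpace ℂ F'] [CompleteSpace F'] (f : F →L[ℂ] F') :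
    (HilbertTensor.map (.id ℂ E) f)† = HilbertTensor.map (.id ℂ E) (f†) := by
  rw [adjoint_map, adjoint_id]

theorem HilbertTensor.map_id_map_id_apply {E E' E'' F : Type*}
    [NormedAddCommGroup E] [InnerProductSpace ℂ E]
    [NormedAddCommGroup E'] [InnerProductSpace ℂ E']
    [NormedAddCommGroup E''] [InnerProductSpace ℂ E'']
    [NormedAddCommGroup F] [InnerProductSpace ℂ F] (f : E' →L[ℂ] E'') (g : E →L[ℂ] E')
    (z : E ⊗ₕ F) :
    HilbertTensor.map f (.id ℂ F) (HilbertTensor.map g (.id ℂ F) z) =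
      HilbertTensor.map (f ∘L g) (.id ℂ F) z := by
  rw [map_comp_apply, ContinuousLinearMap.id_comp]

theorem IsOrthogonalResolution.tensor {I : Type*} {H H₀ : Type*} {Hs : I → Type*}
    [NormedAddCommGroup H] [InnerProductSpace ℂ H] [CompleteSpace H]
    [NormedAddCommGroup H₀] [InnerProductSpace ℂ H₀] [CompleteSpace H₀]
    [∀ i, NormedAddCommGroup (Hs i)] [∀ i, InnerProductSpace ℂ (Hs i)]
    [∀ i, CompleteSpace (Hs i)] {P₀ : H →L[ℂ] H₀} {P : ∀ i, H →L[ℂ] Hs i}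
    (hP : IsOrthogonalResolution P₀ P)
    (E : Type*) [NormedAddCommGroup E] [InnerProductSpace ℂ E] [CompleteSpace E] :
    IsOrthogonalResolution (HilbertTensor.map P₀ (.id ℂ E))
      (fun i => HilbertTensor.map (P i) (.id ℂ E)) := by
  constructor
  · intro y
    rw [adjoint_map_id, map_id_map_id_apply]
    have : P₀ ∘L P₀† = .id ℂ H₀ := by ext1 y; exact hP.zero_zero y
    rw [this, map_id_id]; rfl
  · intro i y
    rw [adjoint_map_id, map_id_map_id_apply]
    have : P₀ ∘L (P i)† = 0 := by ext1 y; exact hP.zero_block i y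
    rw [this, map_zero_left]; rfl
  · intro i y
    rw [adjoint_map_id, map_id_map_id_apply]
    have : P i ∘L (P i)† = .id ℂ (Hs i) := by ext1 y; exact hP.block_self i y
    rw [this, map_id_id]; rfl
  · intro i j hij y
    rw [adjoint_map_id, map_id_map_id_apply]
    have : P i ∘L (P j)† = 0 := by ext1 y; exact hP.block_ne i j hij y
    rw [this, map_zero_left]; rfl
  · intro z h₀ h
    refine HilbertTensor.ext_inner fun x y => ?_
    -- For fixed `y`, the functional `x ↦ ⟨z, x ⊗ y⟩` vanishes on the range of each `P†`, hence on
    -- all of `H`.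
    have key : (innerSL ℂ z) ∘L (tmulL H E).flip y = 0 := by
      refine hP.clm_ext (fun v => ?_) fun i v => ?_
      · simp only [ContinuousLinearMap.comp_apply, ContinuousLinearMap.flip_apply, tmulL_apply,
          innerSL_apply_apply, zero_apply]
        have : tmul ((P₀†) v) y = ((HilbertTensor.map P₀ (.id ℂ E))†) (tmul v y) := by
          rw [adjoint_map_id, map_tmul]; rfl
        rw [this, ContinuousLinearMap.adjoint_inner_right, h₀, inner_zero_left]
      · simp only [ContinuousLinearMap.comp_apply, ContinuousLinearMap.flip_apply, tmulL_apply,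
          innerSL_apply_apply, zero_apply]
        have : tmul (((P i)†) v) y = ((HilbertTensor.map (P i) (.id ℂ E))†) (tmul v y) := by
          rw [adjoint_map_id, map_tmul]; rfl
        rw [this, ContinuousLinearMap.adjoint_inner_right, h, inner_zero_left]
    rw [inner_zero_right, ← inner_conj_symm, map_eq_zero]
    exact DFunLike.congr_fun key x

variable {H : Type*} [NormedAddCommGroup H] [InnerProductSpace ℂ H] [CompleteSpace H]
  {I : Type*} {H₀ : Type*} [NormedAddCommGroup H₀] [InnerProductSpace ℂ H₀] [CompleteSpace H₀]
  {HA : I → Type*} [∀ i, NormedAddCommGroup (HA i)] [∀ i, InnerProductSpace ℂ (HA i)]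
  [∀ i, CompleteSpace (HA i)]
  {HB : I → Type*} [∀ i, NormedAddCommGroup (HB i)] [∀ i, InnerProductSpace ℂ (HB i)]
  [∀ i, CompleteSpace (HB i)]

theorem nullProj_apply (W : BlockSpace H₀ HA HB ≃ₗᵢ[ℂ] H) (x : H) :
    nullProj W x = (W.symm x).fst := rfl

theorem blockProj_apply (W : BlockSpace H₀ HA HB ≃ₗᵢ[ℂ] H) (i : I) (x : H) :
    blockProj W i x = (W.symm x).snd i := rfl

theorem nullProj_adjoint_apply (W : BlockSpace H₀ HA HB ≃ₗᵢ[ℂ] H) (y : H₀) :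
    ((nullProj W)†) y = W (WithLp.toLp 2 (y, 0)) := by
  refine ext_inner_left ℂ fun v => ?_
  rw [ContinuousLinearMap.adjoint_inner_right, ← W.symm.inner_map_map v,
    W.symm_apply_apply, WithLp.prod_inner_apply]
  simp [nullProj_apply]

theorem blockProj_adjoint_apply [DecidableEq I] (W : BlockSpace H₀ HA HB ≃ₗᵢ[ℂ] H) (i : I)
    (y : HA i ⊗ₕ HB i) :
    ((blockProj W i)†) y = W (WithLp.toLp 2 (0, lp.single 2 i y)) := by
  refine ext_inner_left ℂ fun v => ?_
  rw [ContinuousLinearMap.adjoint_inner_right, ← W.symm.inner_map_map v,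
    W.symm_apply_apply, WithLp.prod_inner_apply]
  simp [blockProj_apply, lp.inner_single_right]

theorem isOrthogonalResolution_blockProj (W : BlockSpace H₀ HA HB ≃ₗᵢ[ℂ] H) :
    IsOrthogonalResolution (nullProj W) (blockProj W) := by
  classical
  constructor
  · intro y
    rw [nullProj_adjoint_apply]
    simp [nullProj_apply]
  · intro i y
    rw [blockProj_adjoint_apply]
    simp [nullProj_apply]
  · intro i y
    rw [blockProj_adjoint_apply]
    simp [blockProj_apply]
  · intro i j hij y
    rw [blockProj_adjoint_apply]
    simp [blockProj_apply, hij]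
  · intro x h₀ h
    apply W.symm.injective
    rw [map_zero]
    apply (WithLp.equiv 2 _).injective
    refine Prod.ext h₀ (lp.ext (funext h))

theorem IsAtomicWith.mem_iff {𝒜 : NonUnitalStarSubalgebra ℂ (H →L[ℂ] H)}
    {W : BlockSpace H₀ HA HB ≃ₗᵢ[ℂ] H} (h : IsAtomicWith 𝒜 W) (X : H →L[ℂ] H) :
    X ∈ 𝒜 ↔ ∃ Y : ∀ i, HA i →L[ℂ] HA i, BddAbove (Set.range fun i => ‖Y i‖) ∧
      (∀ x, nullProj W (X x) = 0) ∧
      ∀ i x, blockProj W i (X x) = HilbertTensor.map (Y i) (.id ℂ (HB i)) (blockProj W i x) := by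
  rw [h X]
  refine exists_congr fun Y => and_congr_right fun _ => ?_
  constructor
  · intro h
    refine ⟨fun x => ?_, fun i x => ?_⟩
    · simpa [nullProj_apply] using (h (W.symm x)).1
    · simpa [blockProj_apply] using (h (W.symm x)).2 i
  · rintro ⟨h1, h2⟩ ψ
    refine ⟨?_, fun i => ?_⟩
    · simpa [nullProj_apply] using h1 (W ψ)
    · simpa [blockProj_apply] using h2 i (W ψ)

/-- Membership in the atomic algebra in terms of blocks. -/
theorem IsAtomicWith.mem_of_blocks {𝒜 : NonUnitalStarSubalgebra ℂ (H →L[ℂ] H)}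
    {W : BlockSpace H₀ HA HB ≃ₗᵢ[ℂ] H} (h : IsAtomicWith 𝒜 W) {X : H →L[ℂ] H}
    (h₀ : ∀ x, nullProj W (X x) = 0) (h₀' : ∀ y, X (((nullProj W)†) y) = 0)
    (hne : ∀ i j, i ≠ j → ∀ y, blockProj W i (X (((blockProj W j)†) y)) = 0)
    (hself : ∀ i, IsLeftAmplification (blockProj W i ∘L X ∘L (blockProj W i)†)) : X ∈ 𝒜 := by
  have hP := isOrthogonalResolution_blockProj W
  choose Y hY hY' using fun i => (hself i).exists_eq_map
  refine (h.mem_iff X).2 ⟨Y, ⟨‖X‖, ?_⟩, h₀, fun i x => ?_⟩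
  · rintro _ ⟨i, rfl⟩
    refine (hY i).trans (ContinuousLinearMap.opNorm_le_bound _ (norm_nonneg _) fun y => ?_)
    calc _ ≤ 1 * ‖X (((blockProj W i)†) y)‖ := (blockProj W i).le_of_opNorm_le (hP.norm_le i) _
      _ ≤ ‖X‖ * ‖((blockProj W i)†) y‖ := by rw [one_mul]; exact X.le_opNorm _
      _ = ‖X‖ * ‖y‖ := by rw [hP.norm_adjoint_apply]
  · refine DFunLike.congr_fun (hP.clm_ext (S := blockProj W i ∘L X)
      (T := HilbertTensor.map (Y i) (.id ℂ (HB i)) ∘L blockProj W i) (fun y => ?_)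
      fun j y => ?_) x
    · simp only [ContinuousLinearMap.comp_apply, h₀', hP.block_zero, map_zero]
    · simp only [ContinuousLinearMap.comp_apply]
      by_cases hij : i = j
      · subst hij
        rw [hP.block_self, ← hY']; rfl
      · rw [hne i j hij, hP.block_ne i j hij, map_zero]

/-- These elements, supported in a single block, are the test elements on which the invariance
hypothesis is evaluated. -/
theorem IsAtomicWith.single_mem {𝒜 : NonUnitalStarSubalgebra ℂ (H →L[ℂ] H)}
    {W : BlockSpace H₀ HA HB ≃ₗᵢ[ℂ] H} (h : IsAtomicWith 𝒜 W) (k : I) (Y : HA k →L[ℂ] HA k) :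
    (blockProj W k)† ∘L HilbertTensor.map Y (.id ℂ (HB k)) ∘L blockProj W k ∈ 𝒜 := by
  have hP := isOrthogonalResolution_blockProj W
  refine h.mem_of_blocks (fun x => hP.zero_block k _) (fun y => ?_) (fun i j hij y => ?_)
    fun i => ?_
  · simp [hP.block_zero]
  · by_cases hkj : k = j
    · subst hkj
      exact hP.block_ne i k hij _
    · simp [hP.block_ne k j hkj]
  · by_cases hki : k = i
    · subst hki
      convert isLeftAmplification_map (B := HB k) Y using 1
      ext1 y
      simp [hP.block_self]
    · refine ⟨0, fun a a' b b' => ?_⟩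
      simp [hP.block_ne k i hki]

end AtomicAlgebra

/-! ### Operators acting on one tensor factor, and semilocal operators. -/

noncomputable section LocalOperators

open HilbertTensor

/-- Convergence of the coefficients `s k a a'` themselves is not assumed; evaluation at a unit
vector `b₀` provides it, and the case `B = 0` is trivial. -/
theorem isLeftAmplification_of_hasSum {ι A B : Type*}
    [NormedAddCommGroup A] [InnerProductSpace ℂ A]
    [NormedAddCommGroup B] [InnerProductSpace ℂ B] {N : A ⊗ₕ B →L[ℂ] A ⊗ₕ B} (s : ι → A → A → ℂ)
    (h : ∀ a a' b b', HasSum (fun k => s k a a' * ⟪b, b'⟫_ℂ) ⟪tmul a b, N (tmul a' b')⟫_ℂ) :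
    IsLeftAmplification N := by
  obtain ⟨b₀, -, hb₀⟩ := exists_norm_le_one_unit B
  refine ⟨fun a a' => ⟪tmul a b₀, N (tmul a' b₀)⟫_ℂ, fun a a' b b' => ?_⟩
  rcases subsingleton_or_nontrivial B with hB | hB
  · simp [Subsingleton.elim b 0, tmul_zero_right]
  · have h1 := h a a' b₀ b₀
    simp only [inner_self_eq_norm_sq_to_K, hb₀ hB] at h1
    simp only [RCLike.ofReal_one, one_pow, mul_one] at h1
    exact (h a a' b b').unique (h1.mul_right _)

variable {A A' A'' B B' B'' F F' HE : Type*}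
  [NormedAddCommGroup A] [InnerProductSpace ℂ A] [CompleteSpace A]
  [NormedAddCommGroup A'] [InnerProductSpace ℂ A'] [CompleteSpace A']
  [NormedAddCommGroup A''] [InnerProductSpace ℂ A''] [CompleteSpace A'']
  [NormedAddCommGroup B] [InnerProductSpace ℂ B] [CompleteSpace B]
  [NormedAddCommGroup B'] [InnerProductSpace ℂ B'] [CompleteSpace B']
  [NormedAddCommGroup B''] [InnerProductSpace ℂ B''] [CompleteSpace B'']
  [NormedAddCommGroup F] [InnerProductSpace ℂ F] [CompleteSpace F]
  [NormedAddCommGroup F'] [InnerProductSpace ℂ F'] [CompleteSpace F']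
  [NormedAddCommGroup HE] [InnerProductSpace ℂ HE] [CompleteSpace HE]

set_option linter.unusedSectionVars false

theorem assoc_ampRight (T : B' →L[ℂ] B ⊗ₕ HE) (z : A ⊗ₕ B') :
    assoc A B HE (ampRight A T z) = HilbertTensor.map (.id ℂ A) T z := by
  simp [ampRight]

theorem assoc_amplify (Y : A →L[ℂ] A) (z : (A ⊗ₕ B) ⊗ₕ HE) :
    assoc A B HE (HilbertTensor.map (HilbertTensor.map Y (.id ℂ B)) (.id ℂ HE) z) =
      HilbertTensor.map Y (.id ℂ (B ⊗ₕ HE)) (assoc A B HE z) := by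
  rw [assoc_map_map_id, map_id_id]

theorem amplify_ampRight (Y : A →L[ℂ] A) (T : B' →L[ℂ] B ⊗ₕ HE) (z : A ⊗ₕ B') :
    HilbertTensor.map (HilbertTensor.map Y (.id ℂ B)) (.id ℂ HE) (ampRight A T z) =
      ampRight A T (HilbertTensor.map Y (.id ℂ B') z) := by
  apply (assoc A B HE).injective
  rw [assoc_amplify, assoc_ampRight, assoc_ampRight, map_comp_apply, map_comp_apply]
  rfl

theorem norm_ampRight_le (T : B' →L[ℂ] B ⊗ₕ HE) : ‖ampRight A T‖ ≤ ‖T‖ := by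
  refine ContinuousLinearMap.opNorm_le_bound _ T.opNorm_nonneg fun z => ?_
  rw [← (assoc A B HE).norm_map, assoc_ampRight]
  exact ContinuousLinearMap.le_of_opNorm_le _ (norm_map_id_left_le T) z

theorem adjoint_ampRight (T : B' →L[ℂ] B ⊗ₕ HE) : (ampRight A T)† = ampRightOut A (T†) := by
  ext1 z
  refine ext_inner_left ℂ fun v => ?_
  rw [ContinuousLinearMap.adjoint_inner_right, ← (assoc A B HE).inner_map_map, assoc_ampRight,
    ← ContinuousLinearMap.adjoint_inner_right, adjoint_id_map]
  rfl

theorem ampRightOut_ampRight (T : B' →L[ℂ] B ⊗ₕ HE) (z : A ⊗ₕ B') :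
    ampRightOut A (T†) (ampRight A T z) = HilbertTensor.map (.id ℂ A) (T† ∘L T) z := by
  change HilbertTensor.map (.id ℂ A) (T†) (assoc A B HE (ampRight A T z)) = _
  rw [assoc_ampRight, map_comp_apply]
  rfl

theorem assoc_semilocal (U : F ⊗ₕ B' →L[ℂ] B ⊗ₕ HE) (T : A' →L[ℂ] A ⊗ₕ F) (z : A' ⊗ₕ B') :
    assoc A B HE (semilocal U T z) =
      HilbertTensor.map (.id ℂ A) U (assoc A F B' (HilbertTensor.map T (.id ℂ B') z)) := by
  change assoc A B HE (ampRight A U _) = _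
  rw [assoc_ampRight]
  rfl

theorem inner_map_id_map {G : Type*} [NormedAddCommGroup G] [InnerProductSpace ℂ G]
    [CompleteSpace G] (U : F →L[ℂ] G) (U' : F' →L[ℂ] G) (Y : A →L[ℂ] A) (z : A ⊗ₕ F)
    (w : A ⊗ₕ F') :
    ⟪HilbertTensor.map (.id ℂ A) U z, HilbertTensor.map Y (.id ℂ G)
      (HilbertTensor.map (.id ℂ A) U' w)⟫_ℂ = ⟪z, HilbertTensor.map Y (U† ∘L U') w⟫_ℂ := by
  rw [← ContinuousLinearMap.adjoint_inner_right, adjoint_id_map, map_comp_apply, map_comp_apply]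
  rfl

/-- After reassociation `Y` acts on the factor `A` and commutes with `1 ⊗ U'`. The two isometries
therefore meet as `U† U'`, which is where their orthogonality relations enter. -/
theorem inner_semilocal (U : F ⊗ₕ B' →L[ℂ] B ⊗ₕ HE) (T : A' →L[ℂ] A ⊗ₕ F)
    (U' : F' ⊗ₕ B'' →L[ℂ] B ⊗ₕ HE) (T' : A'' →L[ℂ] A ⊗ₕ F') (Y : A →L[ℂ] A) (z : A' ⊗ₕ B')
    (w : A'' ⊗ₕ B'') :
    ⟪semilocal U T z, HilbertTensor.map (HilbertTensor.map Y (.id ℂ B)) (.id ℂ HE)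
      (semilocal U' T' w)⟫_ℂ =
      ⟪assoc A F B' (HilbertTensor.map T (.id ℂ B') z), HilbertTensor.map Y (U† ∘L U')
        (assoc A F' B'' (HilbertTensor.map T' (.id ℂ B'') w))⟫_ℂ := by
  rw [← inner_map_id_map, ← assoc_semilocal, ← assoc_semilocal, ← assoc_amplify,
    LinearIsometryEquiv.inner_map_map]

theorem inner_semilocal_of_orthogonal {U : F ⊗ₕ B' →L[ℂ] B ⊗ₕ HE}
    {U' : F' ⊗ₕ B'' →L[ℂ] B ⊗ₕ HE} (h : U† ∘L U' = 0) (T : A' →L[ℂ] A ⊗ₕ F)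
    (T' : A'' →L[ℂ] A ⊗ₕ F') (Y : A →L[ℂ] A) (z : A' ⊗ₕ B') (w : A'' ⊗ₕ B'') :
    ⟪semilocal U T z, HilbertTensor.map (HilbertTensor.map Y (.id ℂ B)) (.id ℂ HE)
      (semilocal U' T' w)⟫_ℂ = 0 := by
  have h0 : HilbertTensor.map Y (0 : F' ⊗ₕ B'' →L[ℂ] F ⊗ₕ B') = 0 :=
    clm_ext fun x y => by simp [map_tmul, tmul_zero_right]
  rw [inner_semilocal, h, h0, zero_apply, inner_zero_right]

theorem inner_semilocal_self {U : F ⊗ₕ B' →L[ℂ] B ⊗ₕ HE} (h : U† ∘L U = .id ℂ (F ⊗ₕ B'))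
    (T : A' →L[ℂ] A ⊗ₕ F) (Y : A →L[ℂ] A) (a a' : A') (b b' : B') :
    ⟪semilocal U T (tmul a b), HilbertTensor.map (HilbertTensor.map Y (.id ℂ B)) (.id ℂ HE)
      (semilocal U T (tmul a' b'))⟫_ℂ =
      ⟪T a, HilbertTensor.map Y (.id ℂ F) (T a')⟫_ℂ * ⟪b, b'⟫_ℂ := by
  rw [inner_semilocal, h, ← assoc_amplify, (assoc A F B').inner_map_map, map_tmul, map_tmul,
    map_tmul, inner_tmul]
  rfl

end LocalOperators

/-! ### Adjoints of block diagonal operators. -/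

noncomputable section BlockAdjoint

variable {I : Type*} {H H₀ H' H₀' : Type*} {Hs Hs' : I → Type*}
  [NormedAddCommGroup H] [InnerProductSpace ℂ H] [CompleteSpace H]
  [NormedAddCommGroup H₀] [InnerProductSpace ℂ H₀] [CompleteSpace H₀]
  [∀ i, NormedAddCommGroup (Hs i)] [∀ i, InnerProductSpace ℂ (Hs i)] [∀ i, CompleteSpace (Hs i)]
  [NormedAddCommGroup H'] [InnerProductSpace ℂ H'] [CompleteSpace H']
  [NormedAddCommGroup H₀'] [InnerProductSpace ℂ H₀'] [CompleteSpace H₀']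
  [∀ i, NormedAddCommGroup (Hs' i)] [∀ i, InnerProductSpace ℂ (Hs' i)]
  [∀ i, CompleteSpace (Hs' i)]

namespace IsOrthogonalResolution

variable {P₀ : H →L[ℂ] H₀} {P : ∀ i, H →L[ℂ] Hs i} (hP : IsOrthogonalResolution P₀ P)
  {R₀ : H' →L[ℂ] H₀'} {R : ∀ i, H' →L[ℂ] Hs' i} (hR : IsOrthogonalResolution R₀ R)
  {D : ∀ i, Hs i →L[ℂ] Hs' i} {T : H →L[ℂ] H'}
  (hT : SOTHasSum (fun i => (R i)† ∘L D i ∘L P i) T)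

include hP hT in
theorem apply_zero_of_sotHasSum (y : H₀) : T ((P₀†) y) = 0 := by
  have h := hT ((P₀†) y)
  simp only [ContinuousLinearMap.comp_apply, hP.block_zero, map_zero] at h
  exact h.unique hasSum_zero

include hR hT

theorem adjoint_apply_zero_of_sotHasSum (y : H₀') : (T†) ((R₀†) y) = 0 :=
  ext_inner_left ℂ fun v => by
    rw [ContinuousLinearMap.adjoint_inner_right, ContinuousLinearMap.adjoint_inner_right,
      hR.zero_apply_of_sotHasSum hT, inner_zero_left, inner_zero_right]

theorem adjoint_apply_block_of_sotHasSum (i : I) (y : Hs' i) :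
    (T†) (((R i)†) y) = ((P i)†) (((D i)†) y) :=
  ext_inner_left ℂ fun v => by
    rw [ContinuousLinearMap.adjoint_inner_right, ContinuousLinearMap.adjoint_inner_right,
      hR.block_apply_of_sotHasSum hT, ContinuousLinearMap.adjoint_inner_right,
      ContinuousLinearMap.adjoint_inner_right]

include hP in
theorem apply_block_of_sotHasSum (i : I) (y : Hs i) :
    T (((P i)†) y) = ((R i)†) (D i y) := by
  refine hR.eq_of_forall ?_ fun j => ?_
  · rw [hR.zero_apply_of_sotHasSum hT, hR.zero_block]
  · rw [hR.block_apply_of_sotHasSum hT]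
    by_cases hij : j = i
    · subst hij
      rw [hP.block_self, hR.block_self]
    · rw [hP.block_ne j i hij, hR.block_ne j i hij, map_zero]

end IsOrthogonalResolution

theorem IsOrthogonalResolution.isSelfAdjoint_of_sotHasSum {P₀ : H →L[ℂ] H₀}
    {P : ∀ i, H →L[ℂ] Hs i} (hP : IsOrthogonalResolution P₀ P) {D : ∀ i, Hs i →L[ℂ] Hs i}
    {T : H →L[ℂ] H} (hT : SOTHasSum (fun i => (P i)† ∘L D i ∘L P i) T)
    (hD : ∀ i, (D i)† = D i) : T† = T :=
  hP.clm_ext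
    (fun y => by rw [hP.adjoint_apply_zero_of_sotHasSum hT, hP.apply_zero_of_sotHasSum hT])
    fun i y => by
      rw [hP.adjoint_apply_block_of_sotHasSum hT, hP.apply_block_of_sotHasSum hP hT, hD]

end BlockAdjoint

/-! ### Gauge invariance of the generator. -/

noncomputable section Gauge

variable {H HE : Type*}
  [NormedAddCommGroup H] [InnerProductSpace ℂ H] [CompleteSpace H]
  [NormedAddCommGroup HE] [InnerProductSpace ℂ HE]

/-- The generator does not change on `X` under the gauge transformation by an operator `T` which
intertwines `X` and `X ⊗ 1`. -/
theorem gklsMap_gauge {V T : H →L[ℂ] H ⊗ₕ HE} {K X : H →L[ℂ] H}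
    (h : ∀ x, HilbertTensor.map X (.id ℂ HE) (T x) = T (X x))
    (h' : ∀ z, (T†) (HilbertTensor.map X (.id ℂ HE) z) = X ((T†) z)) :
    gklsMap (V + T) (K + T† ∘L V + (1 / 2 : ℂ) • T† ∘L T) X = gklsMap V K X := by
  ext1 x
  -- `X` commutes with `T†T`, so `T†(X ⊗ 1)T` is cancelled by the two halves of `T†T` in the drift.
  -- The cross terms `X T†V` and `V†T X` are cancelled by `T†V` and its adjoint.
  have hc : (T†) (T (X x)) = X ((T†) (T x)) := by rw [← h, h']
  have hadj : (K + T† ∘L V + (1 / 2 : ℂ) • T† ∘L T)† =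
      K† + V† ∘L T + (1 / 2 : ℂ) • T† ∘L T := by
    simp only [map_add, map_smulₛₗ, ContinuousLinearMap.adjoint_comp,
      ContinuousLinearMap.adjoint_adjoint, map_div₀, map_one, map_ofNat]
  simp only [gklsMap, hadj]
  simp only [map_add, sub_apply, add_apply, smul_apply, ContinuousLinearMap.comp_apply, map_smul,
    h, h', hc]
  module

end Gauge

/-! ### The normal form implies invariance. -/

noncomputable section NormalFormSufficiency

open HilbertTensor

set_option linter.unusedSectionVars false

variable {H : Type*} [NormedAddCommGroup H] [InnerProductSpace ℂ H] [CompleteSpace H]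
  {HE : Type*} [NormedAddCommGroup HE] [InnerProductSpace ℂ HE] [CompleteSpace HE]
  {I : Type*} {H₀ : Type*} [NormedAddCommGroup H₀] [InnerProductSpace ℂ H₀] [CompleteSpace H₀]
  {HA : I → Type*} [∀ i, NormedAddCommGroup (HA i)] [∀ i, InnerProductSpace ℂ (HA i)]
  [∀ i, CompleteSpace (HA i)]
  {HB : I → Type*} [∀ i, NormedAddCommGroup (HB i)] [∀ i, InnerProductSpace ℂ (HB i)]
  [∀ i, CompleteSpace (HB i)]
  {𝒜 : NonUnitalStarSubalgebra ℂ (H →L[ℂ] H)} {W : BlockSpace H₀ HA HB ≃ₗᵢ[ℂ] H}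

theorem HilbertTensor.map_id_apply_congr {E E' E'' F : Type*}
    [NormedAddCommGroup E] [InnerProductSpace ℂ E]
    [NormedAddCommGroup E'] [InnerProductSpace ℂ E']
    [NormedAddCommGroup E''] [InnerProductSpace ℂ E'']
    [NormedAddCommGroup F] [InnerProductSpace ℂ F] {f : E' →L[ℂ] E''} {g : E →L[ℂ] E'}
    {h : E →L[ℂ] E''} (hfg : ∀ x, f (g x) = h x) (z : E ⊗ₕ F) :
    HilbertTensor.map f (.id ℂ F) (HilbertTensor.map g (.id ℂ F) z) =
      HilbertTensor.map h (.id ℂ F) z := by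
  rw [map_id_map_id_apply]
  congr 2
  ext1 x
  exact hfg x

theorem IsAtomicWith.null_amplify (h𝒜 : IsAtomicWith 𝒜 W) {X : H →L[ℂ] H} (hX : X ∈ 𝒜)
    (z : H ⊗ₕ HE) :
    HilbertTensor.map (nullProj W) (.id ℂ HE) (HilbertTensor.map X (.id ℂ HE) z) = 0 := by
  obtain ⟨Y, -, h0, -⟩ := (h𝒜.mem_iff X).1 hX
  rw [map_id_apply_congr (h := 0) (fun x => by rw [h0]; rfl), map_zero_left]
  rfl

theorem block_amplify {X : H →L[ℂ] H} {Y : ∀ i, HA i →L[ℂ] HA i}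
    (h : ∀ i x, blockProj W i (X x) = HilbertTensor.map (Y i) (.id ℂ (HB i)) (blockProj W i x))
    (i : I) (z : H ⊗ₕ HE) :
    HilbertTensor.map (blockProj W i) (.id ℂ HE) (HilbertTensor.map X (.id ℂ HE) z) =
      HilbertTensor.map (HilbertTensor.map (Y i) (.id ℂ (HB i))) (.id ℂ HE)
        (HilbertTensor.map (blockProj W i) (.id ℂ HE) z) := by
  rw [map_id_apply_congr (h := HilbertTensor.map (Y i) (.id ℂ (HB i)) ∘L blockProj W i)
    (fun x => by rw [h]; rfl), ← map_id_map_id_apply]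

theorem IsAtomicWith.adjoint_mem {X : H →L[ℂ] H} (hX : X ∈ 𝒜) : X† ∈ 𝒜 := by
  rw [← ContinuousLinearMap.star_eq_adjoint]
  exact star_mem hX

theorem IsAtomicWith.null_apply (h𝒜 : IsAtomicWith 𝒜 W) {X : H →L[ℂ] H} (hX : X ∈ 𝒜) (x : H) :
    nullProj W (X x) = 0 := by
  obtain ⟨Y, -, h0, -⟩ := (h𝒜.mem_iff X).1 hX
  exact h0 x

theorem IsAtomicWith.apply_null (h𝒜 : IsAtomicWith 𝒜 W) {X : H →L[ℂ] H} (hX : X ∈ 𝒜) (y : H₀) :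
    X (((nullProj W)†) y) = 0 :=
  ext_inner_left ℂ fun v => by
    rw [← ContinuousLinearMap.adjoint_inner_left, ContinuousLinearMap.adjoint_inner_right,
      h𝒜.null_apply (adjoint_mem hX), inner_zero_left, inner_zero_right]

theorem IsAtomicWith.amplify_null (h𝒜 : IsAtomicWith 𝒜 W) {X : H →L[ℂ] H} (hX : X ∈ 𝒜)
    (y : H₀ ⊗ₕ HE) :
    HilbertTensor.map X (.id ℂ HE) (((HilbertTensor.map (nullProj W) (.id ℂ HE))†) y) = 0 := by
  rw [adjoint_map_id, map_id_apply_congr (h := 0) (fun x => by rw [h𝒜.apply_null hX]; rfl),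
    map_zero_left]
  rfl

/-- A sum of blocks `1 ⊗ B i` intertwines `X` and `X ⊗ 1`. -/
theorem IsAtomicWith.amplify_apply_of_sotHasSum (h𝒜 : IsAtomicWith 𝒜 W)
    {B : ∀ i, HB i →L[ℂ] HB i ⊗ₕ HE} {T : H →L[ℂ] H ⊗ₕ HE}
    (hT : SOTHasSum (fun i => (HilbertTensor.map (blockProj W i) (.id ℂ HE))† ∘L
      ampRight (HA i) (B i) ∘L blockProj W i) T) {X : H →L[ℂ] H} (hX : X ∈ 𝒜) (x : H) :
    HilbertTensor.map X (.id ℂ HE) (T x) = T (X x) := by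
  have hP := isOrthogonalResolution_blockProj W
  have hR := hP.tensor HE
  obtain ⟨Y, -, -, hY⟩ := (h𝒜.mem_iff X).1 hX
  refine hR.eq_of_forall ?_ fun i => ?_
  · rw [h𝒜.null_amplify hX, hR.zero_apply_of_sotHasSum hT]
  · rw [block_amplify hY, hR.block_apply_of_sotHasSum hT, hR.block_apply_of_sotHasSum hT,
      amplify_ampRight, hY]

theorem IsAtomicWith.adjoint_amplify_of_sotHasSum (h𝒜 : IsAtomicWith 𝒜 W)
    {B : ∀ i, HB i →L[ℂ] HB i ⊗ₕ HE} {T : H →L[ℂ] H ⊗ₕ HE}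
    (hT : SOTHasSum (fun i => (HilbertTensor.map (blockProj W i) (.id ℂ HE))† ∘L
      ampRight (HA i) (B i) ∘L blockProj W i) T) {X : H →L[ℂ] H} (hX : X ∈ 𝒜) (z : H ⊗ₕ HE) :
    (T†) (HilbertTensor.map X (.id ℂ HE) z) = X ((T†) z) :=
  ext_inner_left ℂ fun v => by
    rw [ContinuousLinearMap.adjoint_inner_right, ← ContinuousLinearMap.adjoint_inner_left,
      adjoint_map_id, h𝒜.amplify_apply_of_sotHasSum hT (adjoint_mem hX),
      ← ContinuousLinearMap.adjoint_inner_right, ContinuousLinearMap.adjoint_inner_left]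

/-- The sum of the blocks `1 ⊗ (B i)† B i` is `T† T`, where `T` is the sum of the blocks
`1 ⊗ B i`. -/
theorem sotHasSum_adjoint_comp_self {B : ∀ i, HB i →L[ℂ] HB i ⊗ₕ HE} {T : H →L[ℂ] H ⊗ₕ HE}
    (hT : SOTHasSum (fun i => (HilbertTensor.map (blockProj W i) (.id ℂ HE))† ∘L
      ampRight (HA i) (B i) ∘L blockProj W i) T) :
    SOTHasSum (fun i => (blockProj W i)† ∘L
      HilbertTensor.map (.id ℂ (HA i)) ((B i)† ∘L B i) ∘L blockProj W i) (T† ∘L T) := by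
  have hR := (isOrthogonalResolution_blockProj W).tensor HE
  intro x
  have h := (hT x).mapL (T†)
  simp only [ContinuousLinearMap.comp_apply] at h ⊢
  convert! h using 2 with i
  rw [hR.adjoint_apply_block_of_sotHasSum hT, adjoint_ampRight, ampRightOut_ampRight]

/-- The mixed series in the drift is `T†` applied termwise to a convergent series, so its
convergence is automatic and its sum is the gauge term `T† S`. -/
theorem sotHasSum_adjoint_comp {B : ∀ i, HB i →L[ℂ] HB i ⊗ₕ HE} {T S : H →L[ℂ] H ⊗ₕ HE}
    (hT : SOTHasSum (fun i => (HilbertTensor.map (blockProj W i) (.id ℂ HE))† ∘L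
      ampRight (HA i) (B i) ∘L blockProj W i) T)
    {D : ∀ i j, HA j ⊗ₕ HB j →L[ℂ] (HA i ⊗ₕ HB i) ⊗ₕ HE}
    (hS : SOTHasSum (fun p : I × I => (HilbertTensor.map (blockProj W p.1) (.id ℂ HE))† ∘L
      D p.1 p.2 ∘L blockProj W p.2) S) :
    SOTHasSum (fun p : I × I => (blockProj W p.1)† ∘L ampRightOut (HA p.1) ((B p.1)†) ∘L
      D p.1 p.2 ∘L blockProj W p.2) (T† ∘L S) := by
  have hR := (isOrthogonalResolution_blockProj W).tensor HE
  intro x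
  have h := (hS x).mapL (T†)
  simp only [ContinuousLinearMap.comp_apply] at h ⊢
  convert! h using 2 with p
  rw [hR.adjoint_apply_block_of_sotHasSum hT, adjoint_ampRight]

/-- The completely positive part built from semilocal operators with orthogonal isometries leaves
the atomic algebra invariant. -/
theorem IsAtomicWith.semilocal_conj_mem (h𝒜 : IsAtomicWith 𝒜 W)
    {HF : I → I → Type*} [∀ i j, NormedAddCommGroup (HF i j)]
    [∀ i j, InnerProductSpace ℂ (HF i j)] [∀ i j, CompleteSpace (HF i j)]
    {A : ∀ i j, HA j →L[ℂ] HA i ⊗ₕ HF i j} {U : ∀ i j, HF i j ⊗ₕ HB j →L[ℂ] HB i ⊗ₕ HE}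
    (hU : ∀ i k, (U i k)† ∘L U i k = .id ℂ (HF i k ⊗ₕ HB k))
    (hU' : ∀ i k l, k ≠ l → (U i k)† ∘L U i l = 0) {S : H →L[ℂ] H ⊗ₕ HE}
    (hS : SOTHasSum (fun p : I × I => (HilbertTensor.map (blockProj W p.1) (.id ℂ HE))† ∘L
      semilocal (U p.1 p.2) (A p.1 p.2) ∘L blockProj W p.2) S) {X : H →L[ℂ] H} (hX : X ∈ 𝒜) :
    S† ∘L HilbertTensor.map X (.id ℂ HE) ∘L S ∈ 𝒜 := by
  have hP := isOrthogonalResolution_blockProj W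
  have hR := hP.tensor HE
  obtain ⟨Y, -, -, hY⟩ := (h𝒜.mem_iff X).1 hX
  have hS₀ := hP.apply_zero_of_sotHasSum₂
    (D := fun i j => semilocal (U i j) (A i j)) (R := fun i => HilbertTensor.map (blockProj W i)
      (.id ℂ HE)) hS
  have hSb := hP.block_of_sotHasSum₂ hR (D := fun i j => semilocal (U i j) (A i j)) hS
  -- Parseval over the intermediate block `k`; the null component is absent because `S` has no null
  -- row.
  have hsum : ∀ i j (ξ : HA i ⊗ₕ HB i) (η : HA j ⊗ₕ HB j),
      HasSum (fun k => ⟪semilocal (U k i) (A k i) ξ,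
        HilbertTensor.map (HilbertTensor.map (Y k) (.id ℂ (HB k))) (.id ℂ HE)
          (semilocal (U k j) (A k j) η)⟫_ℂ)
        ⟪ξ, blockProj W i ((S† ∘L HilbertTensor.map X (.id ℂ HE) ∘L S)
          (((blockProj W j)†) η))⟫_ℂ := by
    intro i j ξ η
    have h := hR.hasSum_inner (S (((blockProj W i)†) ξ))
      (HilbertTensor.map X (.id ℂ HE) (S (((blockProj W j)†) η)))
      (hR.zero_apply_of_sotHasSum₂ (D := fun i j => semilocal (U i j) (A i j)) hS _)
    simp only [hSb, block_amplify hY] at h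
    rwa [← ContinuousLinearMap.adjoint_inner_right, ContinuousLinearMap.adjoint_inner_left] at h
  refine h𝒜.mem_of_blocks (fun x => ?_) (fun y => ?_) (fun i j hij y => ?_) fun i => ?_
  · refine ext_inner_left ℂ fun v => ?_
    rw [← ContinuousLinearMap.adjoint_inner_left, ContinuousLinearMap.comp_apply,
      ContinuousLinearMap.adjoint_inner_right, hS₀, inner_zero_left, inner_zero_right]
  · simp only [ContinuousLinearMap.comp_apply, hS₀, map_zero]
  · refine ext_inner_left ℂ fun v => ?_
    have h := hsum i j v y
    simp only [inner_semilocal_of_orthogonal (hU' _ i j hij)] at h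
    rw [inner_zero_right]
    exact h.unique hasSum_zero
  · refine isLeftAmplification_of_hasSum
      (fun k a a' => ⟪A k i a, HilbertTensor.map (Y k) (.id ℂ (HF k i)) (A k i a')⟫_ℂ)
      fun a a' b b' => ?_
    have h := hsum i i (tmul a b) (tmul a' b')
    simp only [inner_semilocal_self (hU _ i)] at h
    exact h

theorem IsAtomicWith.mem_of_sotHasSum (h𝒜 : IsAtomicWith 𝒜 W) {D : ∀ i, HA i →L[ℂ] HA i}
    {T : H →L[ℂ] H} (hT : SOTHasSum (fun i => (blockProj W i)† ∘L
      HilbertTensor.map (D i) (.id ℂ (HB i)) ∘L blockProj W i) T) : T ∈ 𝒜 := by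
  have hP := isOrthogonalResolution_blockProj W
  refine h𝒜.mem_of_blocks (hP.zero_apply_of_sotHasSum hT) (hP.apply_zero_of_sotHasSum hT)
    (fun i j hij y => ?_) fun i => ?_
  · rw [hP.block_apply_of_sotHasSum hT, hP.block_ne i j hij, map_zero]
  · convert isLeftAmplification_map (B := HB i) (D i) using 1
    ext1 y
    simp only [ContinuousLinearMap.comp_apply]
    rw [hP.block_apply_of_sotHasSum hT, hP.block_self]

theorem IsAtomicWith.commute_of_sotHasSum (h𝒜 : IsAtomicWith 𝒜 W) {D : ∀ i, HB i →L[ℂ] HB i}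
    {T : H →L[ℂ] H} (hT : SOTHasSum (fun i => (blockProj W i)† ∘L
      HilbertTensor.map (.id ℂ (HA i)) (D i) ∘L blockProj W i) T) {X : H →L[ℂ] H} (hX : X ∈ 𝒜)
    (x : H) : T (X x) = X (T x) := by
  have hP := isOrthogonalResolution_blockProj W
  obtain ⟨Y, -, -, hY⟩ := (h𝒜.mem_iff X).1 hX
  refine hP.eq_of_forall ?_ fun i => ?_
  · rw [h𝒜.null_apply hX, hP.zero_apply_of_sotHasSum hT]
  · rw [hP.block_apply_of_sotHasSum hT, hY, hY, hP.block_apply_of_sotHasSum hT, map_comp_apply,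
      map_comp_apply]
    rfl

theorem SOTHasSum.unique {ι E F : Type*} [NormedAddCommGroup E] [NormedSpace ℂ E]
    [NormedAddCommGroup F] [NormedSpace ℂ F] {f : ι → E →L[ℂ] F} {S T : E →L[ℂ] F}
    (hS : SOTHasSum f S) (hT : SOTHasSum f T) : S = T := by
  ext1 x
  exact (hS x).unique (hT x)

/-- A generator in normal form leaves the atomic algebra invariant. -/
theorem IsAtomicWith.gklsMap_mem_of_normalForm (h𝒜 : IsAtomicWith 𝒜 W)
    {HF : I → I → Type*} [∀ i j, NormedAddCommGroup (HF i j)]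
    [∀ i j, InnerProductSpace ℂ (HF i j)] [∀ i j, CompleteSpace (HF i j)]
    {A : ∀ i j, HA j →L[ℂ] HA i ⊗ₕ HF i j} {U : ∀ i j, HF i j ⊗ₕ HB j →L[ℂ] HB i ⊗ₕ HE}
    (hU : ∀ i k, (U i k)† ∘L U i k = .id ℂ (HF i k ⊗ₕ HB k))
    (hU' : ∀ i k l, k ≠ l → (U i k)† ∘L U i l = 0) {S : H →L[ℂ] H ⊗ₕ HE}
    (hS : SOTHasSum (fun p : I × I => (HilbertTensor.map (blockProj W p.1) (.id ℂ HE))† ∘L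
      semilocal (U p.1 p.2) (A p.1 p.2) ∘L blockProj W p.2) S)
    {B : ∀ i, HB i →L[ℂ] HB i ⊗ₕ HE} {T : H →L[ℂ] H ⊗ₕ HE}
    (hT : SOTHasSum (fun i => (HilbertTensor.map (blockProj W i) (.id ℂ HE))† ∘L
      ampRight (HA i) (B i) ∘L blockProj W i) T)
    {KA : ∀ i, HA i →L[ℂ] HA i} {k : H →L[ℂ] H} (hk : SOTHasSum (fun i => (blockProj W i)† ∘L
      HilbertTensor.map (KA i) (.id ℂ (HB i)) ∘L blockProj W i) k)
    {D : ∀ i, HB i →L[ℂ] HB i} (hD : ∀ i, IsSelfAdjoint (D i)) {g : H →L[ℂ] H}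
    (hg : SOTHasSum (fun i => (blockProj W i)† ∘L
      HilbertTensor.map (.id ℂ (HA i)) (D i) ∘L blockProj W i) g)
    (V₀ : H →L[ℂ] H₀ ⊗ₕ HE) (K₀ : H →L[ℂ] H₀) {X : H →L[ℂ] H} (hX : X ∈ 𝒜) :
    gklsMap ((HilbertTensor.map (nullProj W) (.id ℂ HE))† ∘L V₀ + S + T)
      (T† ∘L S + (1 / 2 : ℂ) • T† ∘L T + k + Complex.I • g + (nullProj W)† ∘L K₀) X ∈ 𝒜 := by
  have hP := isOrthogonalResolution_blockProj W
  have hR := hP.tensor HE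
  set R₀ := HilbertTensor.map (nullProj W) (.id ℂ HE)
  have hTR : T† ∘L R₀† ∘L V₀ = 0 := by
    ext1 x
    exact hR.adjoint_apply_zero_of_sotHasSum hT _
  -- The drift is recognised as the gauge transform by `T` of a drift without `B`. The null row of
  -- `V` may be added inside `T†(·)` because `T†` annihilates it.
  have e1 : T† ∘L S + (1 / 2 : ℂ) • T† ∘L T + k + Complex.I • g + (nullProj W)† ∘L K₀ =
      (k + Complex.I • g + (nullProj W)† ∘L K₀) + T† ∘L (R₀† ∘L V₀ + S) +
        (1 / 2 : ℂ) • T† ∘L T := by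
    rw [ContinuousLinearMap.comp_add, hTR]
    abel
  rw [e1, gklsMap_gauge (h𝒜.amplify_apply_of_sotHasSum hT hX)
    (h𝒜.adjoint_amplify_of_sotHasSum hT hX)]
  have hgs : g† = g := hP.isSelfAdjoint_of_sotHasSum hg fun i => by
    rw [adjoint_id_map, ContinuousLinearMap.isSelfAdjoint_iff'.1 (hD i)]
  have hkm := h𝒜.mem_of_sotHasSum hk
  -- Elements of the algebra annihilate the null space and have no null component. They also commute
  -- with the selfadjoint `g`, so the two `i g` terms cancel.
  have e2 : gklsMap (R₀† ∘L V₀ + S) (k + Complex.I • g + (nullProj W)† ∘L K₀) X =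
      S† ∘L HilbertTensor.map X (.id ℂ HE) ∘L S - k† ∘L X - X ∘L k := by
    ext1 x
    have h1 := h𝒜.apply_null hX
    have h2 := h𝒜.null_apply hX
    have h3 : ∀ y, HilbertTensor.map X (.id ℂ HE) ((R₀†) y) = 0 := h𝒜.amplify_null hX
    have h4 : ∀ z, R₀ (HilbertTensor.map X (.id ℂ HE) z) = 0 := h𝒜.null_amplify hX
    have h5 := h𝒜.commute_of_sotHasSum hg hX
    simp only [gklsMap, map_add, map_smulₛₗ, ContinuousLinearMap.adjoint_comp,
      ContinuousLinearMap.adjoint_adjoint, sub_apply, add_apply, smul_apply,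
      ContinuousLinearMap.comp_apply, RingHom.id_apply, hgs, Complex.conj_I, h1, h2, h3, h4, h5,
      map_zero]
    module
  rw [e2]
  exact sub_mem (sub_mem (h𝒜.semilocal_conj_mem hU hU' hS hX)
    (mul_mem (adjoint_mem hkm) hX)) (mul_mem hX hkm)

end NormalFormSufficiency

/-! ### Invariance forces relations between the blocks of `V` and `K`. -/

noncomputable section NormalFormNecessity

open HilbertTensor InnerProductSpace

set_option linter.unusedSectionVars false

variable {H : Type*} [NormedAddCommGroup H] [InnerProductSpace ℂ H] [CompleteSpace H]
  {HE : Type*} [NormedAddCommGroup HE] [InnerProductSpace ℂ HE] [CompleteSpace HE]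
  {I : Type*} {H₀ : Type*} [NormedAddCommGroup H₀] [InnerProductSpace ℂ H₀] [CompleteSpace H₀]
  {HA : I → Type*} [∀ i, NormedAddCommGroup (HA i)] [∀ i, InnerProductSpace ℂ (HA i)]
  [∀ i, CompleteSpace (HA i)]
  {HB : I → Type*} [∀ i, NormedAddCommGroup (HB i)] [∀ i, InnerProductSpace ℂ (HB i)]
  [∀ i, CompleteSpace (HB i)]
  {𝒜 : NonUnitalStarSubalgebra ℂ (H →L[ℂ] H)} {W : BlockSpace H₀ HA HB ≃ₗᵢ[ℂ] H}
  {V : H →L[ℂ] H ⊗ₕ HE} {K : H →L[ℂ] H}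

/-- The block `(P i ⊗ 1) V (P j)†`, with values in `HA i ⊗ (HB i ⊗ HE)`. -/
def rightBlock (W : BlockSpace H₀ HA HB ≃ₗᵢ[ℂ] H) (V : H →L[ℂ] H ⊗ₕ HE) (i j : I) :
    HA j ⊗ₕ HB j →L[ℂ] HA i ⊗ₕ (HB i ⊗ₕ HE) :=
  ((assoc (HA i) (HB i) HE).toContinuousLinearEquiv :
      (HA i ⊗ₕ HB i) ⊗ₕ HE →L[ℂ] HA i ⊗ₕ (HB i ⊗ₕ HE)) ∘L
    HilbertTensor.map (blockProj W i) (.id ℂ HE) ∘L V ∘L (blockProj W j)†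

theorem rightBlock_apply (i j : I) (y : HA j ⊗ₕ HB j) :
    rightBlock W V i j y = assoc (HA i) (HB i) HE
      (HilbertTensor.map (blockProj W i) (.id ℂ HE) (V (((blockProj W j)†) y))) := rfl

theorem inner_gklsMap_single (k : I) (Y : HA k →L[ℂ] HA k) (x y : H) :
    ⟪x, gklsMap V K ((blockProj W k)† ∘L HilbertTensor.map Y (.id ℂ (HB k)) ∘L blockProj W k) y⟫_ℂ =
      ⟪assoc (HA k) (HB k) HE (HilbertTensor.map (blockProj W k) (.id ℂ HE) (V x)),
        HilbertTensor.map Y (.id ℂ (HB k ⊗ₕ HE))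
          (assoc (HA k) (HB k) HE (HilbertTensor.map (blockProj W k) (.id ℂ HE) (V y)))⟫_ℂ -
      ⟪blockProj W k (K x), HilbertTensor.map Y (.id ℂ (HB k)) (blockProj W k y)⟫_ℂ -
      ⟪blockProj W k x, HilbertTensor.map Y (.id ℂ (HB k)) (blockProj W k (K y))⟫_ℂ := by
  rw [← assoc_amplify, (assoc (HA k) (HB k) HE).inner_map_map, map_id_map_id_apply,
    ← ContinuousLinearMap.adjoint_inner_right (HilbertTensor.map (blockProj W k) (.id ℂ HE)),
    adjoint_map_id, map_id_map_id_apply]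
  simp only [gklsMap, sub_apply, ContinuousLinearMap.comp_apply, inner_sub_right,
    ContinuousLinearMap.adjoint_inner_right]

theorem IsAtomicWith.block_ne (h𝒜 : IsAtomicWith 𝒜 W) {X : H →L[ℂ] H} (hX : X ∈ 𝒜) {i j : I}
    (hij : i ≠ j) (ξ : HA i ⊗ₕ HB i) (η : HA j ⊗ₕ HB j) :
    ⟪((blockProj W i)†) ξ, X (((blockProj W j)†) η)⟫_ℂ = 0 := by
  obtain ⟨Y, -, -, hY⟩ := (h𝒜.mem_iff X).1 hX
  rw [ContinuousLinearMap.adjoint_inner_left, hY,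
    (isOrthogonalResolution_blockProj W).block_ne i j hij, map_zero, inner_zero_right]

theorem IsAtomicWith.isLeftAmplification_block (h𝒜 : IsAtomicWith 𝒜 W) {X : H →L[ℂ] H}
    (hX : X ∈ 𝒜) (i : I) {N : HA i ⊗ₕ HB i →L[ℂ] HA i ⊗ₕ HB i}
    (hN : ∀ ξ η, ⟪ξ, N η⟫_ℂ = ⟪((blockProj W i)†) ξ, X (((blockProj W i)†) η)⟫_ℂ) :
    IsLeftAmplification N := by
  obtain ⟨Y, -, -, hY⟩ := (h𝒜.mem_iff X).1 hX
  obtain ⟨s, hs⟩ := isLeftAmplification_map (B := HB i) (Y i)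
  refine ⟨s, fun a a' b b' => ?_⟩
  rw [hN, ← hs, ContinuousLinearMap.adjoint_inner_left, hY,
    (isOrthogonalResolution_blockProj W).block_self]

section Core

variable (h𝒜 : IsAtomicWith 𝒜 W) (hL : ∀ X ∈ 𝒜, gklsMap V K X ∈ 𝒜)

include h𝒜 hL

/-- On null vectors `L(X)` vanishes, and so do the drift terms. With `Y = 1` the remaining term is
the squared norm of the block. -/
theorem IsAtomicWith.block_null_eq_zero (k : I) (y : H₀) :
    HilbertTensor.map (blockProj W k) (.id ℂ HE) (V (((nullProj W)†) y)) = 0 := by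
  have hP := isOrthogonalResolution_blockProj W
  have h := inner_gklsMap_single (V := V) (K := K) (W := W) k (.id ℂ (HA k))
    (((nullProj W)†) y) (((nullProj W)†) y)
  rw [h𝒜.apply_null (hL _ (h𝒜.single_mem k _))] at h
  simp only [hP.block_zero, map_zero, inner_zero_left, inner_zero_right, sub_zero, map_id_id,
    ContinuousLinearMap.coe_id', id_eq] at h
  exact (map_eq_zero_iff _ (assoc (HA k) (HB k) HE).injective).1 (inner_self_eq_zero.1 h.symm)

theorem IsAtomicWith.drift_null_eq_zero (k : I) (y : H₀) :
    blockProj W k (K (((nullProj W)†) y)) = 0 := by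
  have hP := isOrthogonalResolution_blockProj W
  refine ext_inner_left ℂ fun v => ?_
  have h := inner_gklsMap_single (V := V) (K := K) (W := W) k (.id ℂ (HA k))
    (((blockProj W k)†) v) (((nullProj W)†) y)
  rw [h𝒜.apply_null (hL _ (h𝒜.single_mem k _)), h𝒜.block_null_eq_zero hL] at h
  simp only [hP.block_zero, hP.block_self, map_zero, inner_zero_right, map_id_id,
    ContinuousLinearMap.coe_id', id_eq, zero_sub, sub_zero] at h
  rw [inner_zero_right, ← neg_eq_zero, h]

theorem IsAtomicWith.inner_rightBlock_ne_ne {i j k : I} (hij : i ≠ j) (hki : k ≠ i) (hkj : k ≠ j)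
    (Y : HA k →L[ℂ] HA k) (ξ : HA i ⊗ₕ HB i) (η : HA j ⊗ₕ HB j) :
    ⟪rightBlock W V k i ξ, HilbertTensor.map Y (.id ℂ (HB k ⊗ₕ HE)) (rightBlock W V k j η)⟫_ℂ
      = 0 := by
  have hP := isOrthogonalResolution_blockProj W
  have h := inner_gklsMap_single (V := V) (K := K) (W := W) k Y
    (((blockProj W i)†) ξ) (((blockProj W j)†) η)
  rw [h𝒜.block_ne (hL _ (h𝒜.single_mem k _)) hij, hP.block_ne k i hki, hP.block_ne k j hkj] at h
  simpa only [rightBlock_apply, map_zero, inner_zero_left, inner_zero_right, sub_zero]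
    using h.symm

theorem IsAtomicWith.inner_rightBlock_ne_self {i k : I} (hki : k ≠ i)
    (Y : HA k →L[ℂ] HA k) (ξ : HA i ⊗ₕ HB i) (η : HA k ⊗ₕ HB k) :
    ⟪rightBlock W V k i ξ, HilbertTensor.map Y (.id ℂ (HB k ⊗ₕ HE)) (rightBlock W V k k η)⟫_ℂ
      = ⟪blockProj W k (K (((blockProj W i)†) ξ)), HilbertTensor.map Y (.id ℂ (HB k)) η⟫_ℂ := by
  have hP := isOrthogonalResolution_blockProj W
  have h := inner_gklsMap_single (V := V) (K := K) (W := W) k Y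
    (((blockProj W i)†) ξ) (((blockProj W k)†) η)
  rw [h𝒜.block_ne (hL _ (h𝒜.single_mem k _)) hki.symm, hP.block_ne k i hki, hP.block_self] at h
  rw [inner_zero_left, sub_zero] at h
  exact sub_eq_zero.1 h.symm

variable {a₀ : ∀ k, HA k} (ha₀ : ∀ k, Nontrivial (HA k) → ‖a₀ k‖ = 1)
  (hV : ∀ k b, slice (HB k ⊗ₕ HE) (a₀ k) (rightBlock W V k k (tmul (a₀ k) b)) = 0)

include ha₀ hV

/-- With `Y = |a⟩⟨a₀|` applied to `a₀ ⊗ b`, the vanishing slice removes the contribution of `V` and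
leaves the matrix element of `K` against `a ⊗ b`. -/
theorem IsAtomicWith.drift_ne_eq_zero {i k : I} (hki : k ≠ i) (ξ : HA i ⊗ₕ HB i) :
    blockProj W k (K (((blockProj W i)†) ξ)) = 0 := by
  refine HilbertTensor.ext_inner fun a b => ?_
  rw [inner_zero_right, ← inner_conj_symm, map_eq_zero]
  rcases subsingleton_or_nontrivial (HA k) with hA | hA
  · rw [Subsingleton.elim a 0, tmul_zero_left, inner_zero_right]
  · have h := h𝒜.inner_rightBlock_ne_self hL hki (rankOne ℂ a (a₀ k)) ξ (tmul (a₀ k) b)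
    rw [map_rankOne_id, hV, tmul_zero_right, inner_zero_right, map_rankOne_id, slice_tmul,
      inner_self_eq_norm_sq_to_K, ha₀ k hA] at h
    simpa using h.symm

theorem IsAtomicWith.inner_rightBlock_ne {i j : I} (hij : i ≠ j) (k : I)
    (Y : HA k →L[ℂ] HA k) (ξ : HA i ⊗ₕ HB i) (η : HA j ⊗ₕ HB j) :
    ⟪rightBlock W V k i ξ, HilbertTensor.map Y (.id ℂ (HB k ⊗ₕ HE)) (rightBlock W V k j η)⟫_ℂ
      = 0 := by
  by_cases hki : k = i
  · subst hki
    -- The case `k = i` is the conjugate of the case `k = j`, with `Y` replaced by its adjoint.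
    rw [← ContinuousLinearMap.adjoint_inner_left, adjoint_map_id, ← inner_conj_symm,
      h𝒜.inner_rightBlock_ne_self hL hij, h𝒜.drift_ne_eq_zero hL ha₀ hV hij, inner_zero_left,
      map_zero]
  · by_cases hkj : k = j
    · subst hkj
      rw [h𝒜.inner_rightBlock_ne_self hL hki, h𝒜.drift_ne_eq_zero hL ha₀ hV hki, inner_zero_left]
    · exact h𝒜.inner_rightBlock_ne_ne hL hij hki hkj Y ξ η

theorem IsAtomicWith.rightBlock_conj_ne {i j : I} (hij : i ≠ j) (k : I)
    (Y : HA k →L[ℂ] HA k) : (rightBlock W V k i)† ∘L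
      HilbertTensor.map Y (.id ℂ (HB k ⊗ₕ HE)) ∘L rightBlock W V k j = 0 := by
  ext1 η
  refine ext_inner_left ℂ fun ξ => ?_
  simp only [ContinuousLinearMap.comp_apply]
  rw [ContinuousLinearMap.adjoint_inner_right, h𝒜.inner_rightBlock_ne hL ha₀ hV hij, zero_apply,
    inner_zero_right]

omit ha₀ hV in
theorem IsAtomicWith.isLeftAmplification_self (k : I) (Y : HA k →L[ℂ] HA k) :
    IsLeftAmplification ((rightBlock W V k k)† ∘L
      HilbertTensor.map Y (.id ℂ (HB k ⊗ₕ HE)) ∘L rightBlock W V k k -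
      (blockProj W k ∘L K ∘L (blockProj W k)†)† ∘L HilbertTensor.map Y (.id ℂ (HB k)) -
      HilbertTensor.map Y (.id ℂ (HB k)) ∘L (blockProj W k ∘L K ∘L (blockProj W k)†)) := by
  have hP := isOrthogonalResolution_blockProj W
  refine h𝒜.isLeftAmplification_block (hL _ (h𝒜.single_mem k Y)) k fun ξ η => ?_
  rw [inner_gklsMap_single, hP.block_self, hP.block_self]
  simp only [sub_apply, inner_sub_right]
  rw [ContinuousLinearMap.comp_apply, ContinuousLinearMap.adjoint_inner_right,
    ContinuousLinearMap.comp_apply ((blockProj W k ∘L K ∘L (blockProj W k)†)†),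
    ContinuousLinearMap.adjoint_inner_right]
  rfl

/-- For `k ≠ i` the test element does not meet block `i`, so no drift term appears. For `k = i` the
vanishing slice is needed to separate `V` from `K`. -/
theorem IsAtomicWith.rightBlock_conj_self (k i : I) (Y : HA k →L[ℂ] HA k) :
    IsLeftAmplification ((rightBlock W V k i)† ∘L
      HilbertTensor.map Y (.id ℂ (HB k ⊗ₕ HE)) ∘L rightBlock W V k i) := by
  have hP := isOrthogonalResolution_blockProj W
  by_cases hki : k = i
  · subst hki
    exact isLeftAmplification_conj (ha₀ k) (hV k) (h𝒜.isLeftAmplification_self hL k) Y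
  · refine h𝒜.isLeftAmplification_block (hL _ (h𝒜.single_mem k Y)) i fun ξ η => ?_
    rw [inner_gklsMap_single, hP.block_ne k i hki, hP.block_ne k i hki]
    simp only [ContinuousLinearMap.comp_apply, ContinuousLinearMap.adjoint_inner_right, map_zero,
      inner_zero_left, inner_zero_right, sub_zero]
    rfl

theorem IsAtomicWith.exists_drift_decomposition (k : I) :
    ∃ (f : HA k →L[ℂ] HA k) (g : HB k →L[ℂ] HB k), ‖f‖ ≤ 2 * ‖K‖ ∧ ‖g‖ ≤ ‖K‖ ∧
      IsSelfAdjoint g ∧ ∀ y, blockProj W k (K (((blockProj W k)†) y)) =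
        HilbertTensor.map f (.id ℂ (HB k)) y +
          Complex.I • HilbertTensor.map (.id ℂ (HA k)) g y := by
  have hP := isOrthogonalResolution_blockProj W
  set M := blockProj W k ∘L K ∘L (blockProj W k)† with hM
  have hMn : ‖M‖ ≤ ‖K‖ := ContinuousLinearMap.opNorm_le_bound _ (norm_nonneg _) fun y => by
    calc _ ≤ 1 * ‖K (((blockProj W k)†) y)‖ := (blockProj W k).le_of_opNorm_le (hP.norm_le k) _
      _ ≤ ‖K‖ * ‖((blockProj W k)†) y‖ := by rw [one_mul]; exact K.le_opNorm _
      _ = ‖K‖ * ‖y‖ := by rw [hP.norm_adjoint_apply]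
  -- Subtracting the full generator block from its completely positive part leaves `M†(Y ⊗ 1) + (Y ⊗
  -- 1)M`.
  obtain ⟨f, g, hf, hg, hgs, hfg⟩ := exists_map_add_map (M := M) fun Y => by
    have h := (h𝒜.rightBlock_conj_self hL ha₀ hV k k Y).sub (h𝒜.isLeftAmplification_self hL k Y)
    rw [← hM] at h
    convert! h using 1
    abel
  refine ⟨f, g, hf.trans (by gcongr), hg.trans hMn, hgs, fun y => ?_⟩
  exact DFunLike.congr_fun hfg y

end Core

end NormalFormNecessity

/-! ### Choice of the gauge and assembly of the blocks. -/

noncomputable section NormalFormExistence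

open HilbertTensor

set_option linter.unusedSectionVars false

variable {H : Type*} [NormedAddCommGroup H] [InnerProductSpace ℂ H] [CompleteSpace H]
  {HE : Type*} [NormedAddCommGroup HE] [InnerProductSpace ℂ HE] [CompleteSpace HE]
  {I : Type*} {H₀ : Type*} [NormedAddCommGroup H₀] [InnerProductSpace ℂ H₀] [CompleteSpace H₀]
  {HA : I → Type*} [∀ i, NormedAddCommGroup (HA i)] [∀ i, InnerProductSpace ℂ (HA i)]
  [∀ i, CompleteSpace (HA i)]
  {HB : I → Type*} [∀ i, NormedAddCommGroup (HB i)] [∀ i, InnerProductSpace ℂ (HB i)]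
  [∀ i, CompleteSpace (HB i)]

/-- Subtracting a suitable sum of blocks `1 ⊗ B i` makes one diagonal slice of every diagonal
block vanish. -/
theorem exists_gauge (W : BlockSpace H₀ HA HB ≃ₗᵢ[ℂ] H) (V : H →L[ℂ] H ⊗ₕ HE) {a₀ : ∀ k, HA k}
    (ha : ∀ k, ‖a₀ k‖ ≤ 1) (ha₀ : ∀ k, Nontrivial (HA k) → ‖a₀ k‖ = 1) :
    ∃ (B : ∀ i, HB i →L[ℂ] HB i ⊗ₕ HE) (T : H →L[ℂ] H ⊗ₕ HE),
      SOTHasSum (fun i => (HilbertTensor.map (blockProj W i) (.id ℂ HE))† ∘L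
        ampRight (HA i) (B i) ∘L blockProj W i) T ∧
      ∀ k b, slice (HB k ⊗ₕ HE) (a₀ k) (rightBlock W (V - T) k k (tmul (a₀ k) b)) = 0 := by
  have hP := isOrthogonalResolution_blockProj W
  have hR := hP.tensor HE
  -- `B k` is the slice to be removed: since `⟨a₀, a₀⟩ = 1`, the block `1 ⊗ B k` has slice exactly
  -- `B k` at `a₀`.
  let B : ∀ k, HB k →L[ℂ] HB k ⊗ₕ HE := fun k =>
    slice (HB k ⊗ₕ HE) (a₀ k) ∘L rightBlock W V k k ∘L tmulL (HA k) (HB k) (a₀ k)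
  have hB : ∀ k, ‖B k‖ ≤ ‖V‖ := fun k =>
    ContinuousLinearMap.opNorm_le_bound _ V.opNorm_nonneg fun b => by
      have h1 := (slice (HB k ⊗ₕ HE) (a₀ k)).le_of_opNorm_le ((norm_slice_le (a₀ k)).trans (ha k))
        (rightBlock W V k k (tmul (a₀ k) b))
      have h2 := (HilbertTensor.map (blockProj W k) (.id ℂ HE)).le_of_opNorm_le (hR.norm_le k)
        (V (((blockProj W k)†) (tmul (a₀ k) b)))
      have h3 := V.le_opNorm (((blockProj W k)†) (tmul (a₀ k) b))
      rw [hP.norm_adjoint_apply, norm_tmul] at h3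
      rw [rightBlock_apply, LinearIsometryEquiv.norm_map] at h1
      have h4 : ‖V‖ * (‖a₀ k‖ * ‖b‖) ≤ ‖V‖ * (1 * ‖b‖) :=
        mul_le_mul_of_nonneg_left (mul_le_mul_of_nonneg_right (ha k) (norm_nonneg b))
          V.opNorm_nonneg
      rw [one_mul] at h1 h2 h4
      exact h1.trans (h2.trans (h3.trans h4))
  obtain ⟨T, hT⟩ := hP.exists_blockDiagonal hR (D := fun i => ampRight (HA i) (B i)) (C := ‖V‖)
    fun i => (norm_ampRight_le _).trans (hB i)
  refine ⟨B, T, hT, fun k b => ?_⟩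
  have h1 : rightBlock W (V - T) k k (tmul (a₀ k) b) =
      rightBlock W V k k (tmul (a₀ k) b) - tmul (a₀ k) (B k b) := by
    simp only [rightBlock_apply, sub_apply, map_sub]
    rw [hR.block_apply_of_sotHasSum hT, hP.block_self, assoc_ampRight, map_tmul]
    rfl
  rw [h1, map_sub, slice_tmul]
  rcases subsingleton_or_nontrivial (HA k) with hA | hA
  · rw [Subsingleton.elim (a₀ k) 0]
    simp [slice]
  · rw [inner_self_eq_norm_sq_to_K, ha₀ k hA, RCLike.ofReal_one, one_pow, one_smul]
    exact sub_self _

section Core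

variable {𝒜 : NonUnitalStarSubalgebra ℂ (H →L[ℂ] H)} {W : BlockSpace H₀ HA HB ≃ₗᵢ[ℂ] H}
  {V : H →L[ℂ] H ⊗ₕ HE} {K : H →L[ℂ] H}
  (h𝒜 : IsAtomicWith 𝒜 W) (hL : ∀ X ∈ 𝒜, gklsMap V K X ∈ 𝒜)
  {a₀ : ∀ k, HA k} (ha₀ : ∀ k, Nontrivial (HA k) → ‖a₀ k‖ = 1)
  (hV : ∀ k b, slice (HB k ⊗ₕ HE) (a₀ k) (rightBlock W V k k (tmul (a₀ k) b)) = 0)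

include h𝒜 hL ha₀ hV

theorem IsAtomicWith.exists_drift_sotHasSum :
    ∃ (f : ∀ i, HA i →L[ℂ] HA i) (g : ∀ i, HB i →L[ℂ] HB i) (S T : H →L[ℂ] H),
      (∀ i, IsSelfAdjoint (g i)) ∧
      SOTHasSum (fun i => (blockProj W i)† ∘L
        HilbertTensor.map (f i) (.id ℂ (HB i)) ∘L blockProj W i) S ∧
      SOTHasSum (fun i => (blockProj W i)† ∘L
        HilbertTensor.map (.id ℂ (HA i)) (g i) ∘L blockProj W i) T ∧
      K = S + Complex.I • T + (nullProj W)† ∘L (nullProj W ∘L K) := by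
  have hP := isOrthogonalResolution_blockProj W
  choose f g hf hg hgs hfg using h𝒜.exists_drift_decomposition hL ha₀ hV
  obtain ⟨S, hS⟩ := hP.exists_blockDiagonal hP
    (D := fun i => HilbertTensor.map (f i) (.id ℂ (HB i))) (C := 2 * ‖K‖)
    fun i => (norm_map_id_right_le _).trans (hf i)
  obtain ⟨T, hT⟩ := hP.exists_blockDiagonal hP
    (D := fun i => HilbertTensor.map (.id ℂ (HA i)) (g i)) (C := ‖K‖)
    fun i => (norm_map_id_left_le _).trans (hg i)
  refine ⟨f, g, S, T, hgs, hS, hT, hP.clm_ext (fun y => hP.eq_of_forall ?_ fun i => ?_)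
    fun j y => hP.eq_of_forall ?_ fun i => ?_⟩
  · simp only [add_apply, smul_apply, ContinuousLinearMap.comp_apply, map_add, map_smul,
      hP.zero_apply_of_sotHasSum hS, hP.zero_apply_of_sotHasSum hT, hP.zero_zero, smul_zero,
      zero_add]
  · simp only [add_apply, smul_apply, ContinuousLinearMap.comp_apply, map_add, map_smul,
      hP.block_apply_of_sotHasSum hS, hP.block_apply_of_sotHasSum hT, hP.block_zero, map_zero,
      smul_zero, zero_add]
    exact h𝒜.drift_null_eq_zero hL i y
  · simp only [add_apply, smul_apply, ContinuousLinearMap.comp_apply, map_add, map_smul,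
      hP.zero_apply_of_sotHasSum hS, hP.zero_apply_of_sotHasSum hT, hP.zero_zero, smul_zero,
      zero_add]
  · simp only [add_apply, smul_apply, ContinuousLinearMap.comp_apply, map_add, map_smul,
      hP.block_apply_of_sotHasSum hS, hP.block_apply_of_sotHasSum hT, hP.block_zero, add_zero]
    by_cases hij : i = j
    · subst hij
      rw [hP.block_self]
      exact hfg i y
    · rw [hP.block_ne i j hij, map_zero, map_zero, smul_zero, add_zero]
      exact h𝒜.drift_ne_eq_zero hL ha₀ hV hij y

theorem IsAtomicWith.exists_semilocal_sotHasSum [TopologicalSpace.SeparableSpace HE]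
    [∀ i, TopologicalSpace.SeparableSpace (HB i)] :
    ∃ (HF : I → I → Type uF) (_ : ∀ i j, NormedAddCommGroup (HF i j))
      (_ : ∀ i j, InnerProductSpace ℂ (HF i j)) (_ : ∀ i j, CompleteSpace (HF i j))
      (_ : ∀ i j, TopologicalSpace.SeparableSpace (HF i j))
      (A : ∀ i j, HA j →L[ℂ] HA i ⊗ₕ HF i j)
      (U : ∀ i j, HF i j ⊗ₕ HB j →L[ℂ] HB i ⊗ₕ HE),
      (∀ i j, Isometry (U i j)) ∧ (∀ i k l, k ≠ l → (U i k)† ∘L U i l = 0) ∧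
      SOTHasSum (fun p : I × I => (HilbertTensor.map (blockProj W p.1) (.id ℂ HE))† ∘L
        semilocal (U p.1 p.2) (A p.1 p.2) ∘L blockProj W p.2)
        (V - (HilbertTensor.map (nullProj W) (.id ℂ HE))† ∘L
          HilbertTensor.map (nullProj W) (.id ℂ HE) ∘L V) := by
  have hP := isOrthogonalResolution_blockProj W
  have hR := hP.tensor HE
  have hsep : ∀ k, TopologicalSpace.SeparableSpace (HB k ⊗ₕ HE) := fun k => separableSpace
  choose HF i₁ i₂ i₃ i₄ A U hU hAU hUo using fun k =>
    (exists_semilocal_factorization_family (T := fun j => rightBlock W V k j)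
      (fun j Y => h𝒜.rightBlock_conj_self hL ha₀ hV k j Y)
      (fun i j hij Y => h𝒜.rightBlock_conj_ne hL ha₀ hV hij k Y) : ∃ _ : I → Type uF, _)
  have hsl : ∀ k j, semilocal (U k j) (A k j) =
      HilbertTensor.map (blockProj W k) (.id ℂ HE) ∘L V ∘L (blockProj W j)† := fun k j => by
    ext1 y
    apply (assoc (HA k) (HB k) HE).injective
    rw [assoc_semilocal, hAU k j]
    rfl
  refine ⟨HF, i₁, i₂, i₃, i₄, A, U, hU, hUo, ?_⟩
  simp only [hsl]
  refine hP.sotHasSum_blocks hR (h𝒜.block_null_eq_zero hL) fun i j k hjk y z => ?_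
  have h := h𝒜.inner_rightBlock_ne hL ha₀ hV hjk i (.id ℂ (HA i)) y z
  rw [map_id_id, ContinuousLinearMap.id_apply, rightBlock_apply, rightBlock_apply,
    LinearIsometryEquiv.inner_map_map] at h
  exact h

end Core

end NormalFormExistence

/-! ### The equivalence. -/

set_option maxHeartbeats 1000000 in
theorem mainTheorem3
    {H : Type*} [NormedAddCommGroup H] [InnerProductSpace ℂ H] [CompleteSpace H]
    [TopologicalSpace.SeparableSpace H]
    {HE : Type*} [NormedAddCommGroup HE] [InnerProductSpace ℂ HE] [CompleteSpace HE]
    [TopologicalSpace.SeparableSpace HE]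
    {I : Type*} [Countable I]
    {H₀ : Type*} [NormedAddCommGroup H₀] [InnerProductSpace ℂ H₀] [CompleteSpace H₀]
    [TopologicalSpace.SeparableSpace H₀]
    {HA : I → Type*} [∀ i, NormedAddCommGroup (HA i)] [∀ i, InnerProductSpace ℂ (HA i)]
    [∀ i, CompleteSpace (HA i)] [∀ i, TopologicalSpace.SeparableSpace (HA i)]
    {HB : I → Type*} [∀ i, NormedAddCommGroup (HB i)] [∀ i, InnerProductSpace ℂ (HB i)]
    [∀ i, CompleteSpace (HB i)] [∀ i, TopologicalSpace.SeparableSpace (HB i)]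
    (V : H →L[ℂ] H ⊗ₕ HE) (K : H →L[ℂ] H)
    (𝒜 : NonUnitalStarSubalgebra ℂ (H →L[ℂ] H))
    (W : BlockSpace H₀ HA HB ≃ₗᵢ[ℂ] H) (h𝒜 : IsAtomicWith 𝒜 W) :
    (∀ X ∈ 𝒜, gklsMap V K X ∈ 𝒜) ↔
      ∃ (V₀ : H →L[ℂ] H₀ ⊗ₕ HE) (K₀ : H →L[ℂ] H₀)
        (HF : I → I → Type uF) (_ : ∀ i j, NormedAddCommGroup (HF i j))
        (_ : ∀ i j, InnerProductSpace ℂ (HF i j)) (_ : ∀ i j, CompleteSpace (HF i j))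
        (_ : ∀ i j, TopologicalSpace.SeparableSpace (HF i j))
        (A : ∀ i j, HA j →L[ℂ] HA i ⊗ₕ HF i j)
        (U : ∀ i j, HF i j ⊗ₕ HB j →L[ℂ] HB i ⊗ₕ HE)
        (B : ∀ i, HB i →L[ℂ] HB i ⊗ₕ HE)
        (KA : ∀ i, HA i →L[ℂ] HA i) (HBop : ∀ i, HB i →L[ℂ] HB i)
        (Vsc VB : H →L[ℂ] H ⊗ₕ HE) (KVB KBB K𝒜 H𝒜' : H →L[ℂ] H),
        (∀ i j, Isometry (U i j)) ∧
        (∀ i, IsSelfAdjoint (HBop i)) ∧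
        SOTHasSum (fun p : I × I =>
          HilbertTensor.map ((blockProj W p.1)†) (.id ℂ HE) ∘L
            semilocal (U p.1 p.2) (A p.1 p.2) ∘L blockProj W p.2) Vsc ∧
        SOTHasSum (fun i =>
          HilbertTensor.map ((blockProj W i)†) (.id ℂ HE) ∘L
            ampRight (HA i) (B i) ∘L blockProj W i) VB ∧
        SOTHasSum (fun p : I × I =>
          (blockProj W p.1)† ∘L ampRightOut (HA p.1) ((B p.1)†) ∘L
            semilocal (U p.1 p.2) (A p.1 p.2) ∘L blockProj W p.2) KVB ∧
        SOTHasSum (fun i =>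
          (blockProj W i)† ∘L HilbertTensor.map (.id ℂ (HA i)) ((B i)† ∘L B i) ∘L
            blockProj W i) KBB ∧
        SOTHasSum (fun i =>
          (blockProj W i)† ∘L HilbertTensor.map (KA i) (.id ℂ (HB i)) ∘L blockProj W i) K𝒜 ∧
        SOTHasSum (fun i =>
          (blockProj W i)† ∘L HilbertTensor.map (.id ℂ (HA i)) (HBop i) ∘L
            blockProj W i) H𝒜' ∧
        V = HilbertTensor.map ((nullProj W)†) (.id ℂ HE) ∘L V₀ + Vsc + VB ∧
        K = KVB + (1 / 2 : ℂ) • KBB + K𝒜 + Complex.I • H𝒜' + (nullProj W)† ∘L K₀ ∧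
        (∀ i k, (U i k)† ∘L U i k = .id ℂ (HF i k ⊗ₕ HB k)) ∧
        (∀ i k l, k ≠ l → (U i k)† ∘L U i l = 0) := by
  constructor
  · intro hL
    have hP := isOrthogonalResolution_blockProj W
    have hR := hP.tensor HE
    choose a₀ ha ha₀ using fun k => exists_norm_le_one_unit (HA k)
    obtain ⟨B, T, hT, hslice⟩ := exists_gauge W V ha ha₀
    set V' := V - T with hV'
    -- `K'` is chosen so that the gauge transformation by `T` takes `(V', K')` back to `(V, K)`.
    set K' := K - T† ∘L V' - (1 / 2 : ℂ) • T† ∘L T with hK'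
    have hL' : ∀ X ∈ 𝒜, gklsMap V' K' X ∈ 𝒜 := fun X hX => by
      have h := gklsMap_gauge (V := V') (K := K') (h𝒜.amplify_apply_of_sotHasSum hT hX)
        (h𝒜.adjoint_amplify_of_sotHasSum hT hX)
      have h1 : V' + T = V := by rw [hV']; abel
      have h2 : K' + T† ∘L V' + (1 / 2 : ℂ) • T† ∘L T = K := by rw [hK']; abel
      rw [h1, h2] at h
      rw [← h]
      exact hL X hX
    obtain ⟨HF, i₁, i₂, i₃, i₄, A, U, hU, hUo, hS⟩ :=
      h𝒜.exists_semilocal_sotHasSum hL' ha₀ hslice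
    obtain ⟨f, g, k, h, hgs, hk, hh, hK''⟩ := h𝒜.exists_drift_sotHasSum hL' ha₀ hslice
    set S := V' - (HilbertTensor.map (nullProj W) (.id ℂ HE))† ∘L
      HilbertTensor.map (nullProj W) (.id ℂ HE) ∘L V' with hSdef
    -- `T†` annihilates the null row of `V'`, so the gauge term involves only the semilocal part, as
    -- the normal form of `K` demands.
    have hKV : T† ∘L V' = T† ∘L S := by
      ext1 x
      simp only [hSdef, sub_apply, ContinuousLinearMap.comp_apply, map_sub,
        hR.adjoint_apply_zero_of_sotHasSum hT, sub_zero]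
    have hKVB := sotHasSum_adjoint_comp hT (D := fun i j => semilocal (U i j) (A i j)) hS
    have hKBB := sotHasSum_adjoint_comp_self hT
    simp only [HilbertTensor.adjoint_map_id] at hS hT
    refine ⟨HilbertTensor.map (nullProj W) (.id ℂ HE) ∘L V', nullProj W ∘L K', HF, i₁, i₂, i₃, i₄,
      A, U, B, f, g, S, T, T† ∘L S, T† ∘L T, k, h, hU, hgs, hS, hT, hKVB, hKBB, hk, hh, ?_, ?_, fun i k =>
      (U i k).isometry_iff_adjoint_comp_self.1 (hU i k), hUo⟩
    · rw [← HilbertTensor.adjoint_map_id, hSdef, hV']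
      abel
    · rw [← hKV]
      calc K = K' + T† ∘L V' + (1 / 2 : ℂ) • T† ∘L T := by rw [hK']; abel
        _ = _ := by
          -- `K'` also occurs on the right, in the null row of the drift, and must stay there.
          conv_lhs => rw [hK'']
          abel
  · rintro ⟨V₀, K₀, HF, i₁, i₂, i₃, i₄, A, U, B, KA, D, S, T, KVB, KBB, k, g, -, hD, hS, hT, hKVB,
      hKBB, hk, hg, hVeq, hKeq, hU, hU'⟩ X hX
    simp only [← HilbertTensor.adjoint_map_id] at hS hT hVeq
    rw [hVeq, hKeq, hKVB.unique (sotHasSum_adjoint_comp hT (D := fun i j => semilocal (U i j) (A i j)) hS),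
      hKBB.unique (sotHasSum_adjoint_comp_self hT)]
    exact h𝒜.gklsMap_mem_of_normalForm hU hU' hS hT hk hD hg V₀ K₀ hX
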